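/- Let $X$ be a smooth, geometrically irreducible variety (separated scheme of finite type) over a field $k$ of characteristic $0$, and let $k(X)$ be its function field. Let $\bar k$ be a separable closure of $k$, put $G_k=\mathrm{Gal}(\bar k/k)$, and let $\bar k(X)=k(X)\otimes_k\bar k$ (a field, on which $G_k$ acts through the second factor). Let $\bar k(X)^{\mathrm{ab}}$ be the maximal abelian extension of $\bar k(X)$ inside a separable closure of $\bar k(X)$, and put $G^{[\mathrm{ab}]}_{k(X)}=\mathrm{Gal}(\bar k(X)^{\mathrm{ab}}/k(X))$ and $G^{\mathrm{ab}}_{\bar k(X)}=\mathrm{Gal}(\bar k(X)^{\mathrm{ab}}/\bar k(X))$. Let $\mathrm{ob}(X)\in \mathrm{Ext}^1_{G_k}(\bar k(X)^\star/\bar k^\star,\bar k^\star)$, where $\mathrm{Ext}$ is taken in the abelian category of discrete $G_k$-modules, denote the class of the extension $$0\to \bar k^\star\to \bar k(X)^\star\to \bar k(X)^\star/\bar k^\star\to 0$$ (the elementary obstruction). Then the exact sequence of profinite groups $$1\to G^{\mathrm{ab}}_{\bar k(X)}\to G^{[\mathrm{ab}]}_{k(X)}\to G_k\to 1,$$ in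 which the second map is restriction of automorphisms to $\bar k$, splits (that is, this map $G^{[\mathrm{ab}]}_{k(X)}\to G_k$ admits a continuous homomorphic section) if and only if $\mathrm{ob}(X)$ belongs to the maximal divisible subgroup of $\mathrm{Ext}^1_{G_k}(\bar k(X)^\star/\bar k^\star,\bar k^\star)$. -/

import Mathlib

open CategoryTheory AlgebraicGeometry TensorProduct Limits

universe u v

namespace BirationalSections

section Fields

/-! ### Smooth and geometrically irreducible schemes over a field

The only purpose of this section is that `k(X)` and `k(X) ⊗[k] k̄` are fields. -/

theorem isReduced_of_etale_of_isDomain (P A : Type*) [CommRing P] [IsDomain P] [CommRing A]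
    [Algebra P A] [Algebra.Etale P A] : _root_.IsReduced A := by
  let F := FractionRing P
  have : _root_.IsReduced (F ⊗[P] A) := Algebra.FormallyUnramified.isReduced_of_field F _
  exact isReduced_of_injective (Algebra.TensorProduct.includeRight : A →ₐ[P] F ⊗[P] A)
    (Algebra.TensorProduct.includeRight_injective (IsFractionRing.injective P F))

theorem isReduced_of_smooth (k A : Type*) [Field k] [CommRing A] [Algebra k A] [Algebra.Smooth k A] :
    _root_.IsReduced A := by
  obtain ⟨s, hs, h⟩ := Algebra.Smooth.exists_span_eq_top_isStandardSmooth k A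
  have hred : ∀ x ∈ s, _root_.IsReduced (Localization.Away x) := by
    intro x hx
    have hx' := h x hx
    obtain ⟨n, g, -, hg⟩ := RingHom.IsStandardSmooth.exists_etale_mvPolynomial
      (f := algebraMap k (Localization.Away x)) (RingHom.isStandardSmooth_algebraMap.mpr hx')
    algebraize [g]
    exact isReduced_of_etale_of_isDomain (MvPolynomial (Fin n) k) _
  constructor
  intro a ha
  refine Localization.algebraMap_injective_of_span_eq_top s hs ?_
  funext x
  have := hred x.1 x.2
  rw [map_zero]
  exact (ha.map (algebraMap A (Localization.Away x.1))).eq_zero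

theorem isReduced_of_smooth_of_field {k : Type u} [Field k] {X : Scheme.{u}}
    (f : X ⟶ Spec (.of k)) [Smooth f] : AlgebraicGeometry.IsReduced X := by
  have (i : _) : AlgebraicGeometry.IsReduced (X.affineCover.X i) := by
    have i1 : Smooth (X.affineCover.f i ≫ f) := inferInstance
    obtain ⟨φ, hφ⟩ := Spec.map_surjective (X.affineCover.f i ≫ f)
    have hs : Smooth (Spec.map φ) := by rw [hφ]; assumption
    rw [HasRingHomProperty.Spec_iff (P := @Smooth)] at hs
    algebraize [φ.hom]
    exact (affine_isReduced_iff _).mpr (isReduced_of_smooth k _)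
  exact IsReduced.of_openCover X X.affineCover

theorem irreducibleSpace_of_geometricallyIrreducible {k : Type u} [Field k] {X : Scheme.{u}}
    (f : X ⟶ Spec (.of k)) [GeometricallyIrreducible f] : IrreducibleSpace X :=
  GeometricallyIrreducible.irreducibleSpace_of_subsingleton f

theorem isIntegral_of_smooth {k : Type u} [Field k] {X : Scheme.{u}} (f : X ⟶ Spec (.of k))
    [Smooth f] [GeometricallyIrreducible f] : AlgebraicGeometry.IsIntegral X :=
  have := irreducibleSpace_of_geometricallyIrreducible f
  have := isReduced_of_smooth_of_field f
  isIntegral_of_irreducibleSpace_of_isReduced X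

theorem isDomain_tensorProduct {k : Type u} [Field k] (A K : Type u) [CommRing A] [Field K]
    [Algebra k A] [Algebra k K] [Algebra.Smooth k A]
    [GeometricallyIrreducible (Spec.map (CommRingCat.ofHom (algebraMap k A)))] :
    IsDomain (A ⊗[k] K) := by
  have h1 : _root_.IsReduced (A ⊗[k] K) :=
    have := isReduced_of_smooth K (K ⊗[k] A)
    isReduced_of_injective (Algebra.TensorProduct.comm k A K)
      (Algebra.TensorProduct.comm k A K).injective
  have h2 : IrreducibleSpace (Spec (.of (A ⊗[k] K))) := by
    refine GeometricallyIrreducible.geometrically_irreducibleSpace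
      (f := (Spec.map (CommRingCat.ofHom (algebraMap k A)))) (K := K)
      (Spec.map (CommRingCat.ofHom (algebraMap k K)))
      (Spec.map (CommRingCat.ofHom Algebra.TensorProduct.includeLeftRingHom))
      (Spec.map (CommRingCat.ofHom (Algebra.TensorProduct.includeRight (R := k)).toRingHom)) ?_
    exact isPullback_SpecMap_of_isPushout _ _ _ _ (CommRingCat.isPushout_tensorProduct k A K)
  have h3 : AlgebraicGeometry.IsReduced (Spec (.of (A ⊗[k] K))) := (affine_isReduced_iff _).mpr h1
  exact (affine_isIntegral_iff (.of (A ⊗[k] K))).mp (isIntegral_of_irreducibleSpace_of_isReduced _)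

/-- The embedding of `k` in the function field of an irreducible scheme `f : X ⟶ Spec k`: an element
of `k` is sent to the germ at the generic point of the corresponding global section of `X`. -/
noncomputable def constantsToFunctionField {k : Type u} [Field k] {X : Scheme.{u}}
    (f : X ⟶ Spec (.of k)) [IrreducibleSpace X] : k →+* X.functionField :=
  ((Scheme.ΓSpecIso (.of k)).inv ≫ f.appTop ≫
    X.presheaf.germ ⊤ (genericPoint X) trivial).hom

theorem isField_functionField_tensorProduct {k : Type u} [Field k] {X : Scheme.{u}}
    (f : X ⟶ Spec (.of k)) [Smooth f] [GeometricallyIrreducible f]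
    [AlgebraicGeometry.IsIntegral X] [Algebra k X.functionField]
    (h : algebraMap k X.functionField = constantsToFunctionField f)
    (K : Type u) [Field K] [Algebra k K] [Algebra.IsAlgebraic k K] :
    IsField (X.functionField ⊗[k] K) := by
  obtain ⟨U, hU, hx, -⟩ := X.isBasis_affineOpens.exists_subset_of_mem_open
      (Set.mem_univ (genericPoint X)) isOpen_univ
  obtain ⟨V, hV', rfl⟩ := hU
  have hV : IsAffineOpen V := hV'
  have : Nonempty V := ⟨⟨_, hx⟩⟩
  let φ : CommRingCat.of k ⟶ Γ(X, V) := (Scheme.ΓSpecIso (.of k)).inv ≫ f.appLE ⊤ V (by simp)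
  have hφ : Spec.map φ = hV.fromSpec ≫ f := by
    rw [← IsAffineOpen.SpecMap_appLE_fromSpec f (isAffineOpen_top _) hV (by simp),
      IsAffineOpen.fromSpec_top, Scheme.isoSpec_Spec_inv, ← Spec.map_comp]
  have : Surjective (hV.fromSpec ≫ f) := by
    refine ⟨fun x => ⟨hV.primeIdealOf ⟨_, hx⟩, ?_⟩⟩
    exact Subsingleton.elim (α := PrimeSpectrum k) _ _
  have : Smooth (Spec.map φ) := by rw [hφ]; infer_instance
  have : GeometricallyIrreducible (Spec.map φ) := by rw [hφ]; infer_instance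
  have hs : φ.hom.Smooth := (HasRingHomProperty.Spec_iff (P := @Smooth)).mp ‹_›
  algebraize [φ.hom]
  have : IsScalarTower k Γ(X, V) X.functionField := by
    refine .of_algebraMap_eq' ?_
    rw [h]
    change _ = (φ ≫ X.germToFunctionField V).hom
    have hg : X.presheaf.map (homOfLE (le_top : V ≤ ⊤)).op ≫ X.germToFunctionField V =
        X.presheaf.germ ⊤ (genericPoint X) trivial := X.presheaf.germ_res _ _ _
    rw [constantsToFunctionField, ← hg]
    rfl
  have : GeometricallyIrreducible (Spec.map (CommRingCat.ofHom (algebraMap k Γ(X, V)))) := ‹_›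
  have := functionField_isFractionRing_of_isAffineOpen X V hV
  have : IsDomain (Γ(X, V) ⊗[k] K) := isDomain_tensorProduct Γ(X, V) K (k := k)
  have : IsDomain (X.functionField ⊗[k] K) := by
    let e : (X.functionField ⊗[Γ(X, V)] (Γ(X, V) ⊗[k] K)) ≃ₐ[X.functionField]
        (X.functionField ⊗[k] K) :=
      Algebra.TensorProduct.cancelBaseChange k Γ(X, V) X.functionField X.functionField K
    have : IsDomain (X.functionField ⊗[Γ(X, V)] (Γ(X, V) ⊗[k] K)) := by
      let _ : Algebra (Γ(X, V) ⊗[k] K) (X.functionField ⊗[Γ(X, V)] (Γ(X, V) ⊗[k] K)) :=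
        Algebra.TensorProduct.rightAlgebra
      refine IsLocalization.isDomain_of_le_nonZeroDivisors _
        (M := Algebra.algebraMapSubmonoid (Γ(X, V) ⊗[k] K) (nonZeroDivisors Γ(X, V))) ?_
      refine map_le_nonZeroDivisors_of_injective _ ?_ le_rfl
      exact Algebra.TensorProduct.includeLeft_injective (S := Γ(X, V)) (algebraMap k K).injective
    exact e.symm.toMulEquiv.isDomain
  exact isField_of_isIntegral_of_isField' (R := X.functionField) (Field.toIsField _)

end Fields

section DiscreteModules

/-! ### Discrete modules over a topological group -/

/-- The stabilizer of a vector of a representation. -/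
def repStabilizer {k G V : Type*} [CommRing k] [Group G] [AddCommGroup V] [Module k V]
    (ρ : Representation k G V) (x : V) : Subgroup G where
  carrier := {g : G | ρ g x = x}
  one_mem' := by simp
  mul_mem' {a b} ha hb := by
    change ρ (a * b) x = x
    rw [map_mul, Module.End.mul_apply, show ρ b x = x from hb, show ρ a x = x from ha]
  inv_mem' {a} ha := by
    change ρ a⁻¹ x = x
    nth_rewrite 1 [← show ρ a x = x from ha]
    exact ρ.inv_self_apply a x

section

variable {R : Type} [CommRing R] {G : Type u} [Group G] {A B : Rep.{u} R G} (i : A ⟶ B)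

theorem range_le_comap_range (g : G) :
    LinearMap.range i.hom.toLinearMap ≤ (LinearMap.range i.hom.toLinearMap).comap (B.ρ g) := by
  rintro _ ⟨a, rfl⟩
  exact ⟨A.ρ g a, Rep.hom_comm_apply i g a⟩

/-- The quotient of a representation by the image of a morphism. -/
noncomputable abbrev quotRep : Rep.{u} R G :=
  B.quotient (LinearMap.range i.hom.toLinearMap) (range_le_comap_range i)
/-- The projection to the quotient by the image of a morphism. -/
noncomputable abbrev quotRepMk : B ⟶ quotRep i :=
  B.mkQ (LinearMap.range i.hom.toLinearMap) (range_le_comap_range i)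
end

variable (R : Type) [CommRing R] (G : Type u) [Group G] [TopologicalSpace G]

/-- A representation of a topological group `G` is discrete if the stabilizer of each of its elements
is open in `G`; for a topological group `G` this says that the action map `G × M → M` is continuous
for the discrete topology on `M`. -/
def isDiscreteRep : ObjectProperty (Rep.{u} R G) :=
  fun M => ∀ m : M, IsOpen {g : G | M.ρ g m = m}

variable {R G}
theorem isDiscreteRep_of_injective {M N : Rep.{u} R G} (i : M ⟶ N) (hi : Function.Injective i.hom)
    (hN : isDiscreteRep R G N) : isDiscreteRep R G M := by
  intro m
  convert! hN (i.hom m) using 2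
  ext g
  rw [← Rep.hom_comm_apply, hi.eq_iff]

theorem isDiscreteRep_of_surjective [ContinuousMul G] {M N : Rep.{u} R G} (p : M ⟶ N)
    (hp : Function.Surjective p.hom) (hM : isDiscreteRep R G M) : isDiscreteRep R G N := by
  intro n
  obtain ⟨m, rfl⟩ := hp n
  refine (repStabilizer N.ρ (p.hom m)).isOpen_of_mem_nhds (g := 1)
    (Filter.mem_of_superset ((hM m).mem_nhds (by simp)) fun g hg => ?_)
  change N.ρ g (p.hom m) = p.hom m
  rw [← Rep.hom_comm_apply, show M.ρ g m = m from hg]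

instance : (isDiscreteRep R G).IsClosedUnderSubobjects where
  prop_of_mono f _ h := isDiscreteRep_of_injective f ((Rep.mono_iff_injective f).mp ‹_›) h

instance [ContinuousMul G] : (isDiscreteRep R G).IsClosedUnderQuotients where
  prop_of_epi f _ h := isDiscreteRep_of_surjective f ((Rep.epi_iff_surjective f).mp ‹_›) h

instance : (isDiscreteRep R G).ContainsZero where
  exists_zero := by
    refine ⟨Rep.trivial R G PUnit.{u+1}, (Rep.isZero_iff _ _ _).mpr
      (inferInstanceAs (Subsingleton PUnit)), fun m => ?_⟩
    convert! isOpen_univ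
    exact Set.eq_univ_of_forall fun g => rfl

instance : (isDiscreteRep R G).IsClosedUnderFiniteProducts where
  isClosedUnderLimitsOfShape J _ := by
    refine ⟨?_⟩
    rintro M ⟨p⟩ m
    convert! isOpen_iInter_of_finite (fun j : Discrete J =>
      p.prop_diag_obj j ((p.π.app j).hom m)) using 1
    ext g
    rw [Set.mem_iInter]
    have hcomm (j : Discrete J) : (p.π.app j).hom (M.ρ g m) =
        (p.diag.obj j).ρ g ((p.π.app j).hom m) := Rep.hom_comm_apply (p.π.app j) g m
    refine ⟨fun h j => (hcomm j).symm.trans (congrArg _ h), fun h => ?_⟩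
    exact Concrete.isLimit_ext (p.diag ⋙ forget₂ (Rep.{u} R G) (ModuleCat.{u} R))
      (isLimitOfPreserves (forget₂ (Rep.{u} R G) (ModuleCat.{u} R)) p.isLimit) (M.ρ g m) m
      fun j => (hcomm j).trans (h j)


variable (R G) in
/-- The category of discrete `G`-modules (over `R`; we use `R = ℤ`), a full subcategory of the
category of `R`-linear representations of `G`. It is abelian when `G` is a topological group. -/
abbrev DiscreteModuleCat := (isDiscreteRep R G).FullSubcategory

variable [IsTopologicalGroup G]

/-- The sequence `A → B → B / i(A)` of discrete modules attached to a morphism `i : A ⟶ B`. -/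
noncomputable def quotientSequence {A B : DiscreteModuleCat R G} (i : A ⟶ B) :
    ShortComplex (DiscreteModuleCat R G) where
  X₁ := A
  X₂ := B
  X₃ := ⟨quotRep i.hom, isDiscreteRep_of_surjective (quotRepMk i.hom)
    (Submodule.mkQ_surjective _) B.property⟩
  f := i
  g := (isDiscreteRep R G).homMk (quotRepMk i.hom)
  zero := by
    ext x
    exact (Submodule.Quotient.mk_eq_zero _).mpr ⟨x, rfl⟩

theorem quotientSequence_shortExact {A B : DiscreteModuleCat R G} (i : A ⟶ B)
    (hi : Function.Injective i.hom.hom) : (quotientSequence i).ShortExact := by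
  have hmono : Mono i := (isDiscreteRep R G).ι.mono_of_mono_map
    ((Rep.mono_iff_injective i.hom).mpr hi)
  have hepi : Epi (quotientSequence i).g := (isDiscreteRep R G).ι.epi_of_epi_map
    ((Rep.epi_iff_surjective (quotRepMk i.hom)).mpr (Submodule.mkQ_surjective _))
  refine .mk' (ShortComplex.exact_of_g_is_cokernel _ (CokernelCofork.IsColimit.ofπ _ _
    (fun {Z} φ hφ => (isDiscreteRep R G).homMk
      (Rep.ofHom ⟨Submodule.liftQ _ φ.hom.hom.toLinearMap ?_, ?_⟩)) ?_ ?_)) hmono hepi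
  · rintro _ ⟨a, rfl⟩
    exact congrArg (fun ψ => ψ.hom.hom a) hφ
  · intro g
    refine Submodule.linearMap_qext _ (LinearMap.ext fun x => ?_)
    exact Rep.hom_comm_apply φ.hom g x
  · intro Z φ hφ
    ext x
    rfl
  · intro Z φ hφ m hm
    rw [← cancel_epi (quotientSequence i).g, hm]
    ext x
    rfl

noncomputable instance : HasExt.{u + 1} (DiscreteModuleCat R G) := HasExt.standard _

end DiscreteModules

section Generalities

/-- The largest abelian extension of `F` contained in `Ω`: the compositum of all abelian Galois
extensions of `F` contained in `Ω`. -/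
def maximalAbelianExtension (F : Type u) (Ω : Type v) [Field F] [Field Ω] [Algebra F Ω] :
    IntermediateField F Ω :=
  ⨆ E : {E : IntermediateField F Ω // IsAbelianGalois F E}, E.1

/-- The maximal divisible subgroup of an abelian group: the subgroup generated by all of its
divisible subgroups. -/
def maximalDivisibleSubgroup (A : Type v) [AddCommGroup A] : AddSubgroup A :=
  sSup {D | ∀ n : ℕ, n ≠ 0 → ∀ x ∈ D, ∃ y ∈ D, n • y = x}

end Generalities

section FunctionFields

variable {k : Type u} [Field k] {X : Scheme.{u}} (f : X ⟶ Spec (.of k))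

/-- The function field `k(X)` of a geometrically irreducible scheme `f : X ⟶ Spec k`. -/
def FunctionField [GeometricallyIrreducible f] : Type u :=
  haveI := irreducibleSpace_of_geometricallyIrreducible f
  X.functionField

variable [Smooth f] [GeometricallyIrreducible f]

noncomputable instance : Field (FunctionField f) :=
  haveI := isIntegral_of_smooth f
  inferInstanceAs (Field X.functionField)

/-- The structure of extension of `k` on `k(X)`, given by the structure morphism of `X`. -/
noncomputable instance : Algebra k (FunctionField f) :=
  haveI := isIntegral_of_smooth f
  (constantsToFunctionField f).toAlgebra

variable (kbar : Type u) [Field kbar] [Algebra k kbar]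

/-- The field `k̄(X) = k(X) ⊗[k] k̄`. -/
def GeomFunctionField : Type u := FunctionField f ⊗[k] kbar

theorem isField_functionField_tensor [Algebra.IsAlgebraic k kbar] :
    IsField (FunctionField f ⊗[k] kbar) :=
  haveI := isIntegral_of_smooth f
  letI : Algebra k X.functionField := (constantsToFunctionField f).toAlgebra
  isField_functionField_tensorProduct f rfl kbar

variable [IsSepClosure k kbar]

noncomputable instance : Field (GeomFunctionField f kbar) :=
  haveI : Algebra.IsAlgebraic k kbar := inferInstance
  (isField_functionField_tensor f kbar).toField

noncomputable instance : Algebra (FunctionField f) (GeomFunctionField f kbar) :=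
  inferInstanceAs (Algebra (FunctionField f) (FunctionField f ⊗[k] kbar))

noncomputable instance : Algebra k (GeomFunctionField f kbar) :=
  inferInstanceAs (Algebra k (FunctionField f ⊗[k] kbar))

noncomputable instance : Algebra kbar (GeomFunctionField f kbar) :=
  (Algebra.TensorProduct.includeRight : kbar →ₐ[k] FunctionField f ⊗[k] kbar).toRingHom.toAlgebra

instance : IsScalarTower k (FunctionField f) (GeomFunctionField f kbar) :=
  inferInstanceAs (IsScalarTower k (FunctionField f) (FunctionField f ⊗[k] kbar))

instance : IsScalarTower k kbar (GeomFunctionField f kbar) :=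
  .of_algebraMap_eq fun x =>
    ((Algebra.TensorProduct.includeRight : kbar →ₐ[k] FunctionField f ⊗[k] kbar).commutes x).symm

/-- The natural action of `G_k = Gal(k̄/k)` on `k̄(X) = k(X) ⊗[k] k̄`, through the second factor. -/
noncomputable instance : MulSemiringAction Gal(kbar/k) (GeomFunctionField f kbar) where
  smul σ x := Algebra.TensorProduct.map (AlgHom.id k (FunctionField f)) (σ : kbar →ₐ[k] kbar) x
  one_smul x := congrArg (fun φ : FunctionField f ⊗[k] kbar →ₐ[k] FunctionField f ⊗[k] kbar => φ x)
    (show Algebra.TensorProduct.map (AlgHom.id k (FunctionField f))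
      ((1 : Gal(kbar/k)) : kbar →ₐ[k] kbar) = AlgHom.id k _ by ext <;> rfl)
  mul_smul σ τ x := congrArg (fun φ : FunctionField f ⊗[k] kbar →ₐ[k] FunctionField f ⊗[k] kbar => φ x)
    (show Algebra.TensorProduct.map (AlgHom.id k (FunctionField f))
      ((σ * τ : Gal(kbar/k)) : kbar →ₐ[k] kbar) =
        (Algebra.TensorProduct.map (AlgHom.id k (FunctionField f)) (σ : kbar →ₐ[k] kbar)).comp
        (Algebra.TensorProduct.map (AlgHom.id k (FunctionField f)) (τ : kbar →ₐ[k] kbar)) by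
      ext <;> simp)
  smul_zero σ := map_zero (Algebra.TensorProduct.map (AlgHom.id k (FunctionField f)) (σ : kbar →ₐ[k] kbar))
  smul_add σ x y := map_add (Algebra.TensorProduct.map (AlgHom.id k (FunctionField f)) (σ : kbar →ₐ[k] kbar)) x y
  smul_one σ := map_one (Algebra.TensorProduct.map (AlgHom.id k (FunctionField f)) (σ : kbar →ₐ[k] kbar))
  smul_mul σ x y := map_mul (Algebra.TensorProduct.map (AlgHom.id k (FunctionField f)) (σ : kbar →ₐ[k] kbar)) x y

theorem smul_algebraMap_geomFunctionField (σ : Gal(kbar/k)) (x : kbar) :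
    σ • algebraMap kbar (GeomFunctionField f kbar) x =
      algebraMap kbar (GeomFunctionField f kbar) (σ x) :=
  (Algebra.TensorProduct.map_tmul (AlgHom.id k (FunctionField f)) (σ : kbar →ₐ[k] kbar) 1 x).trans
    (by rw [map_one]; rfl)

theorem isOpen_stabilizer_geomFunctionField (x : GeomFunctionField f kbar) :
    IsOpen (MulAction.stabilizer Gal(kbar/k) x : Set Gal(kbar/k)) := by
  refine TensorProduct.induction_on (motive := fun x : FunctionField f ⊗[k] kbar =>
    IsOpen (MulAction.stabilizer Gal(kbar/k) (show GeomFunctionField f kbar from x) :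
      Set Gal(kbar/k))) x ?_ ?_ ?_
  · convert! isOpen_univ
    exact Set.eq_univ_of_forall fun σ => smul_zero σ
  · intro a y
    have hy : IsOpen (MulAction.stabilizer Gal(kbar/k) y : Set Gal(kbar/k)) :=
      stabilizer_isOpen_of_isIntegral (K := k) y
    refine Subgroup.isOpen_mono (fun σ hσ => ?_) hy
    exact (Algebra.TensorProduct.map_tmul (AlgHom.id k (FunctionField f))
      (σ : kbar →ₐ[k] kbar) a y).trans (congrArg (fun z => a ⊗ₜ[k] z) hσ)
  · intro y z hy hz
    have hyz := hy.inter hz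
    rw [← Subgroup.coe_inf] at hyz
    refine Subgroup.isOpen_mono (fun σ hσ => ?_) hyz
    refine MulAction.mem_stabilizer_iff.mpr ((smul_add σ _ _).trans ?_)
    exact congrArg₂ (· + ·) hσ.1 hσ.2

/-- The action of `G_k` on `k̄(X)ˣ`. -/
noncomputable instance : MulDistribMulAction Gal(kbar/k) (GeomFunctionField f kbar)ˣ where
  smul σ u := Units.map (MulDistribMulAction.toMonoidHom (GeomFunctionField f kbar) σ) u
  one_smul u := Units.ext (one_smul _ (u : GeomFunctionField f kbar))
  mul_smul σ τ u := Units.ext (mul_smul σ τ (u : GeomFunctionField f kbar))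
  smul_one σ := map_one (Units.map (MulDistribMulAction.toMonoidHom (GeomFunctionField f kbar) σ))
  smul_mul σ := map_mul (Units.map (MulDistribMulAction.toMonoidHom (GeomFunctionField f kbar) σ))

theorem coe_smul_units (σ : Gal(kbar/k)) (u : (GeomFunctionField f kbar)ˣ) :
    ((σ • u : (GeomFunctionField f kbar)ˣ) : GeomFunctionField f kbar) =
      σ • (u : GeomFunctionField f kbar) := rfl

/-- The discrete `G_k`-module `k̄ˣ`. -/
noncomputable def constantUnits : DiscreteModuleCat ℤ Gal(kbar/k) where
  obj := Rep.ofMulDistribMulAction Gal(kbar/k) kbarˣ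
  property := fun (a : Additive kbarˣ) => by
    have h : IsOpen (MulAction.stabilizer Gal(kbar/k) (a.toMul : kbar) : Set Gal(kbar/k)) :=
      stabilizer_isOpen_of_isIntegral (K := k) _
    convert! h using 1
    ext σ
    exact Units.ext_iff

/-- The discrete `G_k`-module `k̄(X)ˣ`. -/
noncomputable def functionUnits : DiscreteModuleCat ℤ Gal(kbar/k) where
  obj := Rep.ofMulDistribMulAction Gal(kbar/k) (GeomFunctionField f kbar)ˣ
  property := fun (a : Additive (GeomFunctionField f kbar)ˣ) => by
    convert! isOpen_stabilizer_geomFunctionField f kbar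
      (a.toMul : (GeomFunctionField f kbar)ˣ).val using 1
    ext σ
    exact Units.ext_iff

/-- The inclusion `k̄ˣ → k̄(X)ˣ`. -/
noncomputable def constantUnitsInclusion :
    constantUnits kbar (k := k) ⟶ functionUnits f kbar :=
  (isDiscreteRep ℤ Gal(kbar/k)).homMk (Rep.ofHom
    ⟨(Units.map (algebraMap kbar (GeomFunctionField f kbar) :
      kbar →* GeomFunctionField f kbar)).toAdditive.toIntLinearMap, by
      intro σ
      refine LinearMap.ext fun (a : Additive kbarˣ) => ?_
      exact congrArg Additive.ofMul (Units.ext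
        (u := Units.map (algebraMap kbar (GeomFunctionField f kbar)).toMonoidHom (σ • a.toMul))
        (v := σ • Units.map (algebraMap kbar (GeomFunctionField f kbar)).toMonoidHom a.toMul)
        (smul_algebraMap_geomFunctionField f kbar σ a.toMul.val).symm)⟩)

theorem constantUnitsInclusion_injective :
    Function.Injective (constantUnitsInclusion f kbar).hom.hom := by
  refine fun (a b : Additive kbarˣ) hab => congrArg Additive.ofMul (Units.ext ?_)
  exact (algebraMap kbar (GeomFunctionField f kbar)).injective
    (congrArg (fun c : Additive (GeomFunctionField f kbar)ˣ => c.toMul.val) hab)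

/-- The exact sequence `0 → k̄ˣ → k̄(X)ˣ → k̄(X)ˣ/k̄ˣ → 0` of discrete `G_k`-modules. -/
noncomputable def unitsSequence : ShortComplex (DiscreteModuleCat ℤ Gal(kbar/k)) :=
  quotientSequence (constantUnitsInclusion f kbar)

theorem unitsSequence_shortExact : (unitsSequence f kbar).ShortExact :=
  quotientSequence_shortExact _ (constantUnitsInclusion_injective f kbar)

/-- The discrete `G_k`-module `k̄(X)ˣ/k̄ˣ`. -/
noncomputable def functionUnitsModConstants : DiscreteModuleCat ℤ Gal(kbar/k) :=
  (unitsSequence f kbar).X₃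

/-- The elementary obstruction `ob(X) ∈ Ext¹(k̄(X)ˣ/k̄ˣ, k̄ˣ)`, where the `Ext` group is that of the
abelian category of discrete `G_k`-modules: the class of the extension
`0 → k̄ˣ → k̄(X)ˣ → k̄(X)ˣ/k̄ˣ → 0`. -/
noncomputable def elementaryObstruction :
    Abelian.Ext (functionUnitsModConstants f kbar) (constantUnits kbar (k := k)) 1 :=
  (unitsSequence_shortExact f kbar).extClass

variable (Ω : Type v) [Field Ω] [Algebra (GeomFunctionField f kbar) Ω]

/-- The field `k̄(X)^ab`, where `Ω` is a separable closure of `k̄(X)`. -/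
def GeomFunctionFieldAb : Type v := maximalAbelianExtension (GeomFunctionField f kbar) Ω

noncomputable instance : Field (GeomFunctionFieldAb f kbar Ω) :=
  inferInstanceAs (Field (maximalAbelianExtension (GeomFunctionField f kbar) Ω))

noncomputable instance : Algebra (GeomFunctionField f kbar) (GeomFunctionFieldAb f kbar Ω) :=
  inferInstanceAs (Algebra _ (maximalAbelianExtension (GeomFunctionField f kbar) Ω))

noncomputable instance : Algebra (FunctionField f) (GeomFunctionFieldAb f kbar Ω) :=
  ((algebraMap (GeomFunctionField f kbar) (GeomFunctionFieldAb f kbar Ω)).comp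
    (algebraMap (FunctionField f) (GeomFunctionField f kbar))).toAlgebra

noncomputable instance : Algebra kbar (GeomFunctionFieldAb f kbar Ω) :=
  ((algebraMap (GeomFunctionField f kbar) (GeomFunctionFieldAb f kbar Ω)).comp
    (algebraMap kbar (GeomFunctionField f kbar))).toAlgebra

noncomputable instance : Algebra k (GeomFunctionFieldAb f kbar Ω) :=
  ((algebraMap (GeomFunctionField f kbar) (GeomFunctionFieldAb f kbar Ω)).comp
    (algebraMap k (GeomFunctionField f kbar))).toAlgebra

instance : IsScalarTower k (FunctionField f) (GeomFunctionFieldAb f kbar Ω) :=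
  .of_algebraMap_eq fun x => congrArg (algebraMap (GeomFunctionField f kbar) _)
    (IsScalarTower.algebraMap_apply k (FunctionField f) (GeomFunctionField f kbar) x)

instance : IsScalarTower k kbar (GeomFunctionFieldAb f kbar Ω) :=
  .of_algebraMap_eq fun x => congrArg (algebraMap (GeomFunctionField f kbar) _)
    (IsScalarTower.algebraMap_apply k kbar (GeomFunctionField f kbar) x)

/-- The projection `G_{k(X)}^[ab] = Gal(k̄(X)^ab/k(X)) → G_k = Gal(k̄/k)`, restriction of
automorphisms to `k̄ ⊆ k̄(X)^ab`. -/
noncomputable def abProjection :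
    Gal(GeomFunctionFieldAb f kbar Ω/FunctionField f) →* Gal(kbar/k) :=
  (AlgEquiv.restrictNormalHom kbar).comp (AlgEquiv.restrictScalarsHom k)

end FunctionFields

end BirationalSections

open BirationalSections

namespace BirationalSections

/-! ### Kummer theory: abelian extensions and the group of radicals -/

section Kummer

open IntermediateField Polynomial

/-! Write `K` for `k̄(X)`, `L` for `K^ab` and `M` for `Kˣ/k̄ˣ`. Since `K` contains all roots of
unity, Kummer theory shows that `L` is spanned over `K` by the group `H` of radicals, the elements
of `Lˣ` with a power in `Kˣ`. A continuous section amounts to a discrete action of `G_k` on `H`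
extending the one on `Kˣ`. A section preserves `H` (`exists_action_of_section`). Conversely an
action on `H` extends to `L`, because all linear relations between radicals come from proportional
ones, by independence of the Kummer characters (`exists_ringHom_of_radicalUnits`,
`exists_section_of_action`).

The group `H` is divisible, and `k̄ˣ` is divisible and contains all roots of unity, so `H/k̄ˣ` is
uniquely divisible: it is `M ⊗ ℚ`. If `G_k` acts on `H`, then `ob(X)` is the pullback of the class
of `H` in `Ext¹(M ⊗ ℚ, k̄ˣ)`, a `ℚ`-vector space, so it lies in a divisible subgroup
(`extClass_mem_maximalDivisibleSubgroup`).

Conversely, embed `k̄ˣ` in an injective discrete module `I` with quotient `Q`; then `ob(X)` is the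
pullback of the class of `I` along some `ψ₀ : M → Q`. If `ob(X)` is in the maximal divisible
subgroup, it can be divided successively, and the divisions lift to equivariant maps `ψ n : M → Q`
with `n! • ψ n = ψ₀` (`exists_compatible_sequence`). These extend `ψ₀` to an equivariant map `M ⊗ ℚ
→ Q`. As a group, `H` is the fibre product of `I` and `M ⊗ ℚ` over `Q`, and it inherits the action
from there (`exists_action_of_compatible_sequence`). -/

theorem isAbelianGalois_of_adjoin_root_eq_top {K F : Type*} [Field K] [CharZero K] [Field F]
    [Algebra K F] {n : ℕ} [NeZero n] [HasEnoughRootsOfUnity K n] {α : F} {a : K}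
    (ha : α ^ n = algebraMap K F a) (hα : K⟮α⟯ = ⊤) : IsAbelianGalois K F := by
  obtain ⟨ζ, hζ⟩ := HasEnoughRootsOfUnity.exists_primitiveRoot K n
  have hn : n ≠ 0 := NeZero.ne n
  have hint : IsIntegral K α := .of_pow (Nat.pos_of_ne_zero hn) (ha ▸ isIntegral_algebraMap)
  have hsplit : IsSplittingField K F (X ^ n - C a) := by
    constructor
    · rw [Polynomial.map_sub, Polynomial.map_pow, Polynomial.map_C, Polynomial.map_X]
      exact X_pow_sub_C_splits_of_isPrimitiveRoot
        (hζ.map_of_injective (algebraMap K F).injective) ha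
    · rw [eq_top_iff, ← IntermediateField.top_toSubalgebra, ← hα,
        IntermediateField.adjoin_simple_toSubalgebra_of_isAlgebraic hint.isAlgebraic]
      apply Algebra.adjoin_mono
      rw [Set.singleton_subset_iff, mem_rootSet_of_ne (X_pow_sub_C_ne_zero
        (Nat.pos_of_ne_zero hn) a), aeval_def, eval₂_sub, eval₂_X_pow, eval₂_C, ha, sub_self]
  have hnormal : Normal K F := .of_isSplittingField (X ^ n - C a)
  have hgal : IsGalois K F := {}
  -- Every automorphism scales the generator `α` by an element of `K`, so any two automorphisms
  -- commute.
  have hroot (g : Gal(F/K)) : ∃ c : K, g α = algebraMap K F c * α := by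
    by_cases h0 : α = 0
    · exact ⟨0, by simp [h0]⟩
    have h1 : (g α / α) ^ n = 1 := by
      rw [div_pow, ← map_pow, ha, AlgEquiv.commutes, div_self]
      rw [← ha]
      exact pow_ne_zero n h0
    obtain ⟨i, -, hi⟩ := (hζ.map_of_injective (algebraMap K F).injective).eq_pow_of_pow_eq_one h1
    exact ⟨ζ ^ i, by rw [map_pow, hi, div_mul_cancel₀ _ h0]⟩
  refine { is_comm := ⟨fun g h => ?_⟩ }
  ext x
  have hx : x ∈ K⟮α⟯ := hα ▸ IntermediateField.mem_top
  obtain ⟨c, hc⟩ := hroot g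
  obtain ⟨d, hd⟩ := hroot h
  induction hx using IntermediateField.adjoin_induction with
  | mem x hx =>
    rw [Set.mem_singleton_iff.mp hx]
    simp [hc, hd, mul_left_comm]
  | algebraMap x => simp
  | add x y _ _ hx hy => rw [map_add, map_add, hx, hy]
  | inv x _ hx => rw [map_inv₀, map_inv₀, hx]
  | mul x y _ _ hx hy => rw [map_mul, map_mul, hx, hy]

/-- A finite abelian extension of a field with enough roots of unity is generated by radicals. -/
theorem adjoin_radicals_eq_top {K F : Type*} [Field K] [Field F] [Algebra K F]
    [FiniteDimensional K F] [IsAbelianGalois K F]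
    (hK : ∀ n : ℕ, n ≠ 0 → HasEnoughRootsOfUnity K n) :
    IntermediateField.adjoin K {x : F | ∃ n : ℕ, n ≠ 0 ∧ ∃ a : K, x ^ n = algebraMap K F a} = ⊤ := by
  set S := IntermediateField.adjoin K {x : F | ∃ n : ℕ, n ≠ 0 ∧ ∃ a : K, x ^ n = algebraMap K F a}
  rw [← IsGalois.fixedField_fixingSubgroup S, ← IntermediateField.fixedField_bot]
  congr 1
  rw [Subgroup.eq_bot_iff_forall]
  intro g hg
  by_contra hne
  let _ : CommGroup Gal(F/K) := { mul_comm := mul_comm' }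
  have : HasEnoughRootsOfUnity K (Monoid.exponent Gal(F/K)) :=
    hK _ Monoid.exponent_ne_zero_of_finite
  -- A character `χ` with `χ g ≠ 1` is a cocycle, so Hilbert 90 gives `β` with `h β = χ(h) β` for
  -- all `h`. A power of `β` is invariant, so `β` is a radical which `g` moves.
  obtain ⟨χ, hχ⟩ := CommGroup.exists_apply_ne_one_of_hasEnoughRootsOfUnity Gal(F/K) K hne
  obtain ⟨β, hβ⟩ := groupCohomology.isMulCoboundary₁_of_isMulCocycle₁_of_aut_to_units
    (fun h : Gal(F/K) => Units.map (algebraMap K F).toMonoidHom (χ h)) (fun a b => by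
      ext
      simp [mul_comm])
  have hβ' (h : Gal(F/K)) : h (β : F) = algebraMap K F (χ h) * β := by
    have := congrArg (fun u : Fˣ => (u : F)) (hβ h)
    simp only [AlgEquiv.smul_units_def, Units.val_div_eq_div_val] at this
    rw [div_eq_iff β.ne_zero] at this
    simpa using this
  have hmem : (β : F) ∈ S := by
    refine IntermediateField.subset_adjoin K _ ⟨Monoid.exponent Gal(F/K),
      Monoid.exponent_ne_zero_of_finite, ?_⟩
    have : (β : F) ^ Monoid.exponent Gal(F/K) ∈ (⊥ : IntermediateField K F) := by
      rw [IsGalois.mem_bot_iff_fixed]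
      intro h
      rw [map_pow, hβ', mul_pow, ← map_pow, ← Units.val_pow_eq_pow_val, ← map_pow,
        Monoid.pow_exponent_eq_one]
      simp
    obtain ⟨a, ha⟩ := IntermediateField.mem_bot.mp this
    exact ⟨a, ha.symm⟩
  have h1 := hg ⟨β, hmem⟩
  have h2 : g (β : F) = β := h1
  rw [hβ'] at h2
  apply hχ
  ext
  apply (algebraMap K F).injective
  simpa [β.ne_zero] using h2

section

variable (K : Type*) (L : Type*) [Field K] [Field L] [Algebra K L]

/-- The group of the elements of `Lˣ` which have a power in `Kˣ`. -/
def radicalUnits : Subgroup Lˣ where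
  carrier := {u | ∃ n : ℕ, n ≠ 0 ∧ ∃ x : Kˣ, u ^ n = Units.map (algebraMap K L).toMonoidHom x}
  one_mem' := ⟨1, one_ne_zero, 1, by simp⟩
  mul_mem' := by
    rintro u v ⟨m, hm, x, hx⟩ ⟨n, hn, y, hy⟩
    refine ⟨m * n, mul_ne_zero hm hn, x ^ n * y ^ m, ?_⟩
    rw [mul_pow, pow_mul, hx, mul_comm m n, pow_mul, hy, map_mul, map_pow, map_pow]
  inv_mem' := by
    rintro u ⟨m, hm, x, hx⟩
    exact ⟨m, hm, x⁻¹, by rw [inv_pow, hx, map_inv]⟩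

/-- The inclusion of `Kˣ` in the group of radicals. -/
def baseRadical : Kˣ →* radicalUnits K L :=
  (Units.map (algebraMap K L).toMonoidHom).codRestrict _ fun x => ⟨1, one_ne_zero, x, pow_one _⟩

variable {K L}

@[simp]
theorem coe_baseRadical (x : Kˣ) : ((baseRadical K L x : Lˣ) : L) = algebraMap K L x := rfl

theorem baseRadical_injective : Function.Injective (baseRadical K L) := fun _ _ h =>
  Units.ext ((algebraMap K L).injective (congrArg (fun u : radicalUnits K L => ((u : Lˣ) : L)) h))

theorem exists_pow_eq_baseRadical (u : radicalUnits K L) :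
    ∃ n : ℕ, n ≠ 0 ∧ ∃ x : Kˣ, u ^ n = baseRadical K L x := by
  obtain ⟨n, hn, x, hx⟩ := u.2
  exact ⟨n, hn, x, Subtype.ext hx⟩

theorem mem_radicalUnits_of_pow_mem {u : Lˣ} {n : ℕ} (hn : n ≠ 0)
    (h : u ^ n ∈ radicalUnits K L) : u ∈ radicalUnits K L := by
  obtain ⟨m, hm, x, hx⟩ := h
  exact ⟨n * m, mul_ne_zero hn hm, x, by rw [pow_mul, hx]⟩

end

section

variable {K : Type*} {Ω : Type*} [Field K] [CharZero K] [Field Ω] [Algebra K Ω]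

theorem mem_maximalAbelianExtension_of_pow_mem (hK : ∀ n : ℕ, n ≠ 0 → HasEnoughRootsOfUnity K n)
    {x : Ω} {n : ℕ} (hn : n ≠ 0) {a : K} (h : x ^ n = algebraMap K Ω a) :
    x ∈ maximalAbelianExtension K Ω := by
  have : NeZero n := ⟨hn⟩
  have := hK n hn
  have hx : IsAbelianGalois K K⟮x⟯ := by
    refine isAbelianGalois_of_adjoin_root_eq_top (n := n) (α := AdjoinSimple.gen K x) (a := a) ?_ ?_
    · exact Subtype.ext h
    · refine IntermediateField.map_injective K⟮x⟯.val ?_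
      rw [IntermediateField.adjoin_map, ← AlgHom.fieldRange_eq_map, IntermediateField.fieldRange_val,
        Set.image_singleton]
      rfl
  exact le_iSup (fun E : {E : IntermediateField K Ω // IsAbelianGalois K E} => E.1) ⟨_, hx⟩
    (IntermediateField.mem_adjoin_simple_self K x)

/-- An element of an abelian extension generates a finite abelian one, to which
`adjoin_radicals_eq_top` applies. -/
theorem maximalAbelianExtension_eq_adjoin (hK : ∀ n : ℕ, n ≠ 0 → HasEnoughRootsOfUnity K n) :
    maximalAbelianExtension K Ω = IntermediateField.adjoin K
      {x : Ω | ∃ n : ℕ, n ≠ 0 ∧ ∃ a : K, x ^ n = algebraMap K Ω a} := by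
  refine le_antisymm (iSup_le ?_) (IntermediateField.adjoin_le_iff.mpr ?_)
  · rintro ⟨E, hE⟩ a ha
    have hint : IsIntegral K a := (Algebra.IsIntegral.isIntegral (R := K) (⟨a, ha⟩ : E)).map E.val
    have hle : K⟮a⟯ ≤ E := IntermediateField.adjoin_simple_le_iff.mpr ha
    have : IsAbelianGalois K K⟮a⟯ := .of_algHom (IntermediateField.inclusion hle)
    have : FiniteDimensional K K⟮a⟯ := IntermediateField.adjoin.finiteDimensional hint
    have htop := adjoin_radicals_eq_top (F := K⟮a⟯) hK
    have hgen : AdjoinSimple.gen K a ∈ (⊤ : IntermediateField K K⟮a⟯) := IntermediateField.mem_top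
    rw [← htop] at hgen
    have hmap : a ∈ (IntermediateField.adjoin K {x : K⟮a⟯ | ∃ n : ℕ, n ≠ 0 ∧ ∃ c : K,
        x ^ n = algebraMap K K⟮a⟯ c}).map K⟮a⟯.val := ⟨_, hgen, rfl⟩
    rw [IntermediateField.adjoin_map] at hmap
    refine IntermediateField.adjoin.mono _ _ _ ?_ hmap
    rintro _ ⟨x, ⟨n, hn, c, hx⟩, rfl⟩
    exact ⟨n, hn, c, congrArg K⟮a⟯.val hx⟩
  · rintro x ⟨n, hn, a, h⟩
    exact mem_maximalAbelianExtension_of_pow_mem hK hn h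

theorem isGalois_maximalAbelianExtension : IsGalois K (maximalAbelianExtension K Ω) := by
  have : Normal K (maximalAbelianExtension K Ω) :=
    IntermediateField.normal_iSup (h := fun E => E.2.toIsGalois.to_normal) _
  exact {}

/-- The radicals are algebraic and, with `0`, closed under multiplication, so the field they
generate is just their linear span. -/
theorem span_radicalUnits (hK : ∀ n : ℕ, n ≠ 0 → HasEnoughRootsOfUnity K n) :
    Submodule.span K (Set.range fun u : radicalUnits K (maximalAbelianExtension K Ω) =>
      ((u : (maximalAbelianExtension K Ω)ˣ) : maximalAbelianExtension K Ω)) = ⊤ := by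
  let L := maximalAbelianExtension K Ω
  let R : Submonoid Ω :=
    { carrier := {x : Ω | ∃ n : ℕ, n ≠ 0 ∧ ∃ a : K, x ^ n = algebraMap K Ω a}
      one_mem' := ⟨1, one_ne_zero, 1, by simp⟩
      mul_mem' := by
        rintro u v ⟨m, hm, a, hx⟩ ⟨n, hn, b, hy⟩
        refine ⟨m * n, mul_ne_zero hm hn, a ^ n * b ^ m, ?_⟩
        rw [mul_pow, pow_mul, hx, mul_comm m n, pow_mul, hy, map_mul, map_pow, map_pow] }
  have hint (x : Ω) (hx : x ∈ R) : IsIntegral K x := by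
    obtain ⟨n, hn, a, h⟩ := hx
    exact .of_pow (Nat.pos_of_ne_zero hn) (h ▸ isIntegral_algebraMap)
  rw [eq_top_iff]
  intro y _
  have hy : (y : Ω) ∈ (IntermediateField.adjoin K (R : Set Ω)).toSubalgebra := by
    exact (maximalAbelianExtension_eq_adjoin hK).le y.2
  rw [IntermediateField.adjoin_toSubalgebra_of_isAlgebraic fun x hx => (hint x hx).isAlgebraic,
    ← Subalgebra.mem_toSubmodule, Algebra.adjoin_eq_span, Submonoid.closure_eq] at hy
  have hle : Submodule.span K (R : Set Ω) ≤ (Submodule.span K (Set.range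
      fun u : radicalUnits K L => ((u : Lˣ) : L))).map L.val.toLinearMap := by
    rw [Submodule.span_le]
    rintro x ⟨n, hn, a, h⟩
    by_cases h0 : x = 0
    · rw [h0]
      exact zero_mem _
    have hx := mem_maximalAbelianExtension_of_pow_mem hK hn h
    have ha : a ≠ 0 := by
      rintro rfl
      exact h0 (eq_zero_of_pow_eq_zero (h.trans (map_zero _)))
    have h0' : (⟨x, hx⟩ : L) ≠ 0 := fun h' => h0 (congrArg Subtype.val h')
    refine ⟨⟨x, hx⟩, Submodule.subset_span ⟨⟨Units.mk0 ⟨x, hx⟩ h0', n, hn, Units.mk0 a ha, ?_⟩,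
      rfl⟩, rfl⟩
    exact Units.ext (Subtype.ext h)
  obtain ⟨z, hz, hzy⟩ := hle hy
  rwa [← Subtype.ext (show (z : Ω) = y from hzy)]

/-- Divisibility of the group of radicals: a root in `Ω` of a radical is again a radical, hence lies
in the maximal abelian extension. -/
theorem exists_pow_eq_of_radicalUnits [IsSepClosed Ω]
    (hK : ∀ n : ℕ, n ≠ 0 → HasEnoughRootsOfUnity K n) {n : ℕ} (hn : n ≠ 0)
    (u : radicalUnits K (maximalAbelianExtension K Ω)) : ∃ v, v ^ n = u := by
  have : CharZero Ω := charZero_of_injective_algebraMap (algebraMap K Ω).injective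
  have : NeZero (n : Ω) := ⟨Nat.cast_ne_zero.mpr hn⟩
  obtain ⟨w, hw⟩ := u
  obtain ⟨z, hz⟩ := IsSepClosed.exists_pow_nat_eq ((w : maximalAbelianExtension K Ω) : Ω) n
  obtain ⟨m, hm, x, hx⟩ := id hw
  have hzm : z ^ (n * m) = algebraMap K Ω x := by
    rw [pow_mul, hz]
    exact congrArg (fun w : (maximalAbelianExtension K Ω)ˣ => ((w : maximalAbelianExtension K Ω) : Ω)) hx
  have hzmem := mem_maximalAbelianExtension_of_pow_mem hK (mul_ne_zero hn hm) hzm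
  have h0 : (⟨z, hzmem⟩ : maximalAbelianExtension K Ω) ≠ 0 := by
    intro h
    have hz0 : z = 0 := congrArg Subtype.val h
    rw [hz0, zero_pow (mul_ne_zero hn hm)] at hzm
    exact x.ne_zero ((map_eq_zero _).mp hzm.symm)
  have hpow : Units.mk0 _ h0 ^ n = w := Units.ext (Subtype.ext hz)
  exact ⟨⟨Units.mk0 _ h0, mem_radicalUnits_of_pow_mem hn (hpow ▸ hw)⟩, Subtype.ext hpow⟩

end

section Extension

variable {K L : Type*} [Field K] [Field L] [Algebra K L]

/-- The quotient is a root of unity, hence in `K` and Galois invariant; this makes the Kummer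
character multiplicative. -/
theorem exists_algebraMap_eq_div (hK : ∀ n : ℕ, n ≠ 0 → HasEnoughRootsOfUnity K n)
    (u : radicalUnits K L) (g : Gal(L/K)) :
    ∃ c : K, g ((u : Lˣ) : L) / ((u : Lˣ) : L) = algebraMap K L c := by
  obtain ⟨⟨u, _⟩, n, hn, x, hx⟩ := u
  have hx' : (u : L) ^ n = algebraMap K L x := congrArg Units.val hx
  have : NeZero n := ⟨hn⟩
  have := hK n hn
  obtain ⟨ζ, hζ⟩ := HasEnoughRootsOfUnity.exists_primitiveRoot K n
  have h1 : (g (u : L) / u) ^ n = 1 := by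
    rw [div_pow, ← map_pow, hx', AlgEquiv.commutes, div_self]
    simp
  obtain ⟨i, -, hi⟩ := (hζ.map_of_injective (algebraMap K L).injective).eq_pow_of_pow_eq_one h1
  exact ⟨ζ ^ i, by rw [map_pow, hi]⟩

/-- The Kummer character `g ↦ g u / u` of a radical `u`. -/
def kummerCharacter (hK : ∀ n : ℕ, n ≠ 0 → HasEnoughRootsOfUnity K n)
    (u : radicalUnits K L) : Gal(L/K) →* L where
  toFun g := g ((u : Lˣ) : L) / ((u : Lˣ) : L)
  map_one' := by simp
  map_mul' g h := by
    obtain ⟨c, hc⟩ := exists_algebraMap_eq_div hK u h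
    have hu : ((u : Lˣ) : L) ≠ 0 := Units.ne_zero _
    rw [hc, AlgEquiv.mul_apply, (div_eq_iff hu).mp hc, map_mul, AlgEquiv.commutes]
    ring

/-- Two radicals with the same Kummer character have a Galois invariant ratio, so they are
proportional over `K`. Non-proportional radicals thus have distinct characters, and distinct
characters are linearly independent. -/
theorem linearIndependent_radicalUnits [IsGalois K L]
    (hK : ∀ n : ℕ, n ≠ 0 → HasEnoughRootsOfUnity K n) {ι : Type*} (h : ι → radicalUnits K L)
    (hh : ∀ i j, i ≠ j → ∀ x : Kˣ, h i ≠ baseRadical K L x * h j) :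
    LinearIndependent K fun i => ((h i : Lˣ) : L) := by
  have hu (i : ι) : ((h i : Lˣ) : L) ≠ 0 := Units.ne_zero _
  have hinj : Function.Injective fun i => kummerCharacter hK (h i) := by
    intro i j hij
    by_contra hne
    have hmem : ((h i : Lˣ) : L) / ((h j : Lˣ) : L) ∈ (⊥ : IntermediateField K L) := by
      rw [InfiniteGalois.mem_bot_iff_fixed]
      intro g
      have := DFunLike.congr_fun hij g
      change g ((h i : Lˣ) : L) / ((h i : Lˣ) : L) = g ((h j : Lˣ) : L) / ((h j : Lˣ) : L) at this
      have hg : g ((h j : Lˣ) : L) ≠ 0 := by simp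
      rw [map_div₀, div_eq_div_iff hg (hu j), (div_eq_div_iff (hu i) (hu j)).mp this, mul_comm]
    obtain ⟨a, ha⟩ := IntermediateField.mem_bot.mp hmem
    have ha0 : a ≠ 0 := by
      rintro rfl
      rw [map_zero] at ha
      exact div_ne_zero (hu i) (hu j) ha.symm
    refine hh i j hne (Units.mk0 a ha0) (Subtype.ext (Units.ext ?_))
    change ((h i : Lˣ) : L) = algebraMap K L a * ((h j : Lˣ) : L)
    rw [ha, div_mul_cancel₀ _ (hu j)]
  have hchar := (linearIndependent_monoidHom Gal(L/K) L).comp _ hinj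
  rw [linearIndependent_iff'] at hchar ⊢
  intro s c hc i hi
  -- Applying `g` to the relation multiplies its `i`-th term by the `i`-th Kummer character at `g`:
  -- the terms are the coefficients of a relation between characters.
  have := hchar s (fun i => algebraMap K L (c i) * ((h i : Lˣ) : L)) (by
    funext g
    rw [Finset.sum_apply]
    calc _ = ∑ i ∈ s, g (c i • ((h i : Lˣ) : L)) := Finset.sum_congr rfl fun j _ => by
          change algebraMap K L (c j) * ((h j : Lˣ) : L) * (g ((h j : Lˣ) : L) / ((h j : Lˣ) : L)) = _
          rw [mul_assoc, mul_div_cancel₀ _ (hu j), map_smul, Algebra.smul_def]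
      _ = 0 := by rw [← map_sum, hc, map_zero]) i hi
  rcases mul_eq_zero.mp this with h0 | h0
  · exact (map_eq_zero _).mp h0
  · exact absurd h0 (hu i)

/-- Linear relations between radicals are preserved by the compatible pairs of an endomorphism of
the base field and an endomorphism of the group of radicals. -/
theorem sum_eq_zero_of_sum_eq_zero [IsGalois K L]
    (hK : ∀ n : ℕ, n ≠ 0 → HasEnoughRootsOfUnity K n) (σ : K →+* K)
    (τ : radicalUnits K L →* radicalUnits K L)
    (hτ : ∀ x : Kˣ, τ (baseRadical K L x) = baseRadical K L (Units.map σ.toMonoidHom x))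
    (c : radicalUnits K L →₀ K)
    (hc : (c.sum fun u a => algebraMap K L a * ((u : Lˣ) : L)) = 0) :
    (c.sum fun u a => algebraMap K L (σ a) * ((τ u : Lˣ) : L)) = 0 := by
  classical
  induction hN : c.support.card using Nat.strong_induction_on generalizing c with
  | _ N ih =>
  subst hN
  -- Without proportional radicals in the support, all coefficients vanish. Otherwise `u = x v`, and
  -- moving the term at `u` onto `v` shrinks the support.
  by_cases hdist : ∀ u ∈ c.support, ∀ v ∈ c.support, u ≠ v → ∀ x : Kˣ, u ≠ baseRadical K L x * v
  · have hli := linearIndependent_radicalUnits hK (fun u : c.support => (u : radicalUnits K L))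
      (fun i j hij => hdist _ i.2 _ j.2 fun h => hij (Subtype.ext h))
    rw [Fintype.linearIndependent_iff] at hli
    have h0 := hli (fun u => c u) (by
      rw [Finset.sum_coe_sort c.support (fun u => c u • ((u : Lˣ) : L))]
      simpa only [Algebra.smul_def, Finsupp.sum] using hc)
    refine Finset.sum_eq_zero fun u hu => ?_
    have : c u = 0 := h0 ⟨u, hu⟩
    simp [this]
  · push Not at hdist
    obtain ⟨u, hu, v, hv, huv, x, hx⟩ := hdist
    set d : radicalUnits K L →₀ K := c.erase u + Finsupp.single v (c u * x) with hd
    -- Used for `(σ, τ)` to transport the conclusion, and for the identities to see that `d` is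
    -- still a relation.
    have hsum (s : K →+* K) (t : radicalUnits K L →* radicalUnits K L)
        (ht : t (baseRadical K L x) = baseRadical K L (Units.map s.toMonoidHom x)) :
        (d.sum fun u a => algebraMap K L (s a) * ((t u : Lˣ) : L)) =
          c.sum fun u a => algebraMap K L (s a) * ((t u : Lˣ) : L) := by
      rw [hd, Finsupp.sum_add_index' (by simp) (by simp [add_mul]), Finsupp.sum_single_index (by simp),
        ← Finsupp.add_sum_erase c u _ hu, add_comm]
      congr 1
      have htu : t u = baseRadical K L (Units.map s.toMonoidHom x) * t v := by rw [hx, map_mul, ht]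
      rw [htu]
      simp [mul_assoc]
    rw [← hsum σ τ (hτ x)]
    refine ih d.support.card (Finset.card_lt_card ?_) d ?_ rfl
    · refine Finset.ssubset_of_subset_of_ssubset (s₂ := c.support.erase u) ?_
        (Finset.erase_ssubset hu)
      refine Finsupp.support_add.trans (Finset.union_subset (by simp) ?_)
      exact Finsupp.support_single_subset.trans (by simp [huv.symm, hv])
    · exact (hsum (.id K) (.id _) rfl).trans hc

/-- A compatible pair of an endomorphism of the base field and an endomorphism of the group of
radicals extends to the field generated by the radicals. -/
theorem exists_ringHom_of_radicalUnits [IsGalois K L]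
    (hK : ∀ n : ℕ, n ≠ 0 → HasEnoughRootsOfUnity K n)
    (hspan : Submodule.span K (Set.range fun u : radicalUnits K L => ((u : Lˣ) : L)) = ⊤)
    (σ : K →+* K) (τ : radicalUnits K L →* radicalUnits K L)
    (hτ : ∀ x : Kˣ, τ (baseRadical K L x) = baseRadical K L (Units.map σ.toMonoidHom x)) :
    ∃ φ : L →+* L, (∀ x : K, φ (algebraMap K L x) = algebraMap K L (σ x)) ∧
      ∀ u : radicalUnits K L, φ ((u : Lˣ) : L) = ((τ u : Lˣ) : L) := by
  let j : radicalUnits K L →* L := (Units.coeHom L).comp (radicalUnits K L).subtype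
  let π : MonoidAlgebra K (radicalUnits K L) →+* L :=
    MonoidAlgebra.liftNCRingHom (algebraMap K L) j fun _ _ => Commute.all _ _
  let ρ : MonoidAlgebra K (radicalUnits K L) →+* L :=
    MonoidAlgebra.liftNCRingHom ((algebraMap K L).comp σ) (j.comp τ) fun _ _ => Commute.all _ _
  have hπ : Function.Surjective π := by
    intro y
    have hy : y ∈ Submodule.span K (Set.range fun u : radicalUnits K L => ((u : Lˣ) : L)) :=
      hspan ▸ Submodule.mem_top
    induction hy using Submodule.span_induction with
    | mem y hy =>
      obtain ⟨u, rfl⟩ := hy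
      refine ⟨.single u 1, (MonoidAlgebra.liftNCRingHom_single ..).trans ?_⟩
      simp [j]
    | zero => exact ⟨0, map_zero _⟩
    | add x y _ _ hx hy =>
      obtain ⟨a, rfl⟩ := hx
      obtain ⟨b, rfl⟩ := hy
      exact ⟨a + b, map_add ..⟩
    | smul c x _ hx =>
      obtain ⟨a, rfl⟩ := hx
      refine ⟨.single 1 c * a, (map_mul ..).trans ?_⟩
      rw [Algebra.smul_def]
      congr 1
      refine (MonoidAlgebra.liftNCRingHom_single ..).trans ?_
      simp
  -- `L` is the group algebra of the radicals modulo their linear relations, and `ρ` kills these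
  -- relations.
  have hker : RingHom.ker π ≤ RingHom.ker ρ := by
    intro c hc
    exact sum_eq_zero_of_sum_eq_zero hK σ τ hτ c.coeff hc
  let φ : L →+* L := π.liftOfSurjective hπ ⟨ρ, hker⟩
  have hφ (c) : φ (π c) = ρ c := π.liftOfRightInverse_comp_apply _ _ _ c
  refine ⟨φ, fun x => ?_, fun u => ?_⟩
  · have := hφ (.single 1 x)
    simpa [π, ρ] using this
  · have := hφ (.single u 1)
    simpa [π, ρ, j] using this

theorem ringHom_ext_of_radicalUnits
    (hspan : Submodule.span K (Set.range fun u : radicalUnits K L => ((u : Lˣ) : L)) = ⊤)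
    {φ ψ : L →+* L} (h : ∀ x : K, φ (algebraMap K L x) = ψ (algebraMap K L x))
    (h' : ∀ u : radicalUnits K L, φ ((u : Lˣ) : L) = ψ ((u : Lˣ) : L)) : φ = ψ := by
  ext y
  have hy : y ∈ Submodule.span K (Set.range fun u : radicalUnits K L => ((u : Lˣ) : L)) :=
    hspan ▸ Submodule.mem_top
  induction hy using Submodule.span_induction with
  | mem y hy =>
    obtain ⟨u, rfl⟩ := hy
    exact h' u
  | zero => simp
  | add x y _ _ hx hy => rw [map_add, map_add, hx, hy]
  | smul c x _ hx => rw [Algebra.smul_def, map_mul, map_mul, h, hx]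

end Extension

end Kummer

/-! ### Enough injectives among discrete modules -/

section Injectives

variable {R : Type} [CommRing R] {G : Type u} [Group G]

theorem exists_injective_embedding_rep (A : Rep.{u} R G) :
    ∃ (J : Rep.{u} R G) (i : A ⟶ J), Injective J ∧ Function.Injective i.hom := by
  have : EnoughInjectives (ModuleCat.{u} (MonoidAlgebra R G)) := inferInstance
  have : EnoughInjectives (Rep.{u} R G) :=
    .of_equivalence (Rep.equivalenceModuleMonoidAlgebra (k := R) (G := G)).functor
  exact ⟨Injective.under A, Injective.ι A, inferInstance,
    (Rep.mono_iff_injective _).mp inferInstance⟩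

variable [TopologicalSpace G]

instance [ContinuousMul G] : (isDiscreteRep R G).ι.PreservesMonomorphisms :=
  ObjectProperty.preservesMonomorphisms_ι_of_isNormalEpiCategory _

theorem mono_iff_injective_discrete [ContinuousMul G] {A B : DiscreteModuleCat R G} (i : A ⟶ B) :
    Mono i ↔ Function.Injective i.hom.hom := by
  rw [← Rep.mono_iff_injective]
  exact ⟨fun _ => (isDiscreteRep R G).ι.map_mono i, fun h =>
    (isDiscreteRep R G).ι.mono_of_mono_map h⟩

variable [IsTopologicalGroup G]

/-- The submodule of the elements of a representation which have an open stabilizer. -/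
def discretePart (J : Rep.{u} R G) : Submodule R J where
  carrier := {x | IsOpen {g : G | J.ρ g x = x}}
  zero_mem' := by simp
  add_mem' {x y} hx hy := by
    refine (repStabilizer J.ρ (x + y)).isOpen_of_mem_nhds (g := 1)
      (Filter.mem_of_superset ((hx.inter hy).mem_nhds (by simp)) fun g hg => ?_)
    change J.ρ g (x + y) = x + y
    rw [map_add, show J.ρ g x = x from hg.1, show J.ρ g y = y from hg.2]
  smul_mem' n x hx := by
    refine (repStabilizer J.ρ (n • x)).isOpen_of_mem_nhds (g := 1)
      (Filter.mem_of_superset (IsOpen.mem_nhds hx (by simp)) fun g hg => ?_)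
    change J.ρ g (n • x) = n • x
    rw [map_smul, show J.ρ g x = x from hg]

theorem discretePart_le_comap (J : Rep.{u} R G) (h : G) :
    discretePart J ≤ (discretePart J).comap (J.ρ h) := by
  intro x hx
  change IsOpen {g : G | J.ρ g (J.ρ h x) = J.ρ h x}
  have : {g : G | J.ρ g (J.ρ h x) = J.ρ h x} = (fun g => h⁻¹ * g * h) ⁻¹' {g | J.ρ g x = x} := by
    ext g
    simp only [Set.mem_preimage, Set.mem_ofPred_eq, map_mul, Module.End.mul_apply]
    constructor
    · intro e
      rw [e, J.ρ.inv_self_apply]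
    · intro e
      conv_rhs => rw [← e]
      rw [J.ρ.self_inv_apply]
  rw [this]
  exact IsOpen.preimage (by fun_prop) hx

/-- The discrete part of an injective representation is injective among discrete modules: taking
discrete parts is right adjoint to the inclusion, which preserves monomorphisms. The adjunction is
`hlift`. -/
theorem exists_injective_embedding (A : DiscreteModuleCat R G) :
    ∃ (I : DiscreteModuleCat R G) (i : A ⟶ I), Injective I ∧ Function.Injective i.hom.hom := by
  obtain ⟨J, i, hJ, hi⟩ := exists_injective_embedding_rep A.obj
  let J' : Rep.{u} R G := J.subrepresentation (discretePart J) (discretePart_le_comap J)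
  have hJ' : isDiscreteRep R G J' := by
    intro x
    have hx : IsOpen {g : G | J.ρ g x.1 = x.1} := x.2
    convert! hx using 2
    ext g
    exact Subtype.ext_iff
  let ι : J' ⟶ J := J.subtype (discretePart J) (discretePart_le_comap J)
  have hlift {B : DiscreteModuleCat R G} (φ : B.obj ⟶ J) : ∃ ψ : B.obj ⟶ J', ψ ≫ ι = φ := by
    have hmem (b : B.obj) : φ.hom b ∈ discretePart J := by
      have hb : IsOpen {g : G | B.obj.ρ g b = b} := B.property b
      refine (repStabilizer J.ρ (φ.hom b)).isOpen_of_mem_nhds (g := 1)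
        (Filter.mem_of_superset (hb.mem_nhds (by simp)) fun g hg => ?_)
      change J.ρ g (φ.hom b) = φ.hom b
      rw [← Rep.hom_comm_apply, show B.obj.ρ g b = b from hg]
    refine ⟨Rep.ofHom ⟨φ.hom.toLinearMap.codRestrict _ hmem, fun g => ?_⟩, ?_⟩
    · refine LinearMap.ext fun b => Subtype.ext ?_
      exact Rep.hom_comm_apply φ g b
    · ext b
      rfl
  obtain ⟨i', hi'⟩ := hlift i
  refine ⟨⟨J', hJ'⟩, (isDiscreteRep R G).homMk i', ⟨fun {B D} f m hm => ?_⟩, ?_⟩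
  · have hm' : Mono m.hom := (isDiscreteRep R G).ι.map_mono m
    obtain ⟨e, he⟩ := hlift (Injective.factorThru (f.hom ≫ ι) m.hom)
    refine ⟨(isDiscreteRep R G).homMk e, ?_⟩
    ext b
    have := congrArg (fun h => h.hom b) (Injective.comp_factorThru (f.hom ≫ ι) m.hom)
    rw [← he] at this
    exact this
  · intro a b hab
    apply hi
    rw [← hi']
    exact congrArg (fun x => x.1) hab

end Injectives

/-! ### Divisibility of extension classes -/

section Divisible

variable {C : Type*} [Category C] [Abelian C] [HasExt.{v} C]

theorem exists_nsmul_eq_of_mem_maximalDivisibleSubgroup {A : Type*} [AddCommGroup A] {x : A}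
    (hx : x ∈ maximalDivisibleSubgroup A) {n : ℕ} (hn : n ≠ 0) :
    ∃ y ∈ maximalDivisibleSubgroup A, n • y = x := by
  rw [maximalDivisibleSubgroup, sSup_eq_iSup'] at hx
  induction hx using AddSubgroup.iSup_induction' with
  | hp D x hx =>
    obtain ⟨y, hy, rfl⟩ := D.2 n hn x hx
    exact ⟨y, le_sSup D.2 hy, rfl⟩
  | h1 => exact ⟨0, zero_mem _, smul_zero _⟩
  | hadd x y _ _ hx hy =>
    obtain ⟨a, ha, rfl⟩ := hx
    obtain ⟨b, hb, rfl⟩ := hy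
    exact ⟨a + b, add_mem ha hb, smul_add _ _ _⟩

/-- Pulling back a given extension class, as an additive function of the morphism. -/
noncomputable def extPullback {Q A : C} (e : Abelian.Ext Q A 1) (M : C) :
    (M ⟶ Q) →+ Abelian.Ext M A 1 :=
  AddMonoidHom.mk' (fun ψ => (Abelian.Ext.mk₀ ψ).comp e (zero_add 1)) fun ψ χ => by
    rw [Abelian.Ext.mk₀_add, Abelian.Ext.add_comp]

theorem extPullback_apply {Q A M : C} (e : Abelian.Ext Q A 1) (ψ : M ⟶ Q) :
    extPullback e M ψ = (Abelian.Ext.mk₀ ψ).comp e (zero_add 1) := rfl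

/-- The class is the pullback along `ψ` of a class in `Ext¹(Q, A)`. Multiplication by `n ≠ 0` is
invertible on `Q`, hence on that group, whose image under pullback is therefore divisible. -/
theorem extClass_mem_maximalDivisibleSubgroup {A B M H Q : C} {a : A ⟶ B} {b : B ⟶ M}
    {c : A ⟶ H} {d : H ⟶ Q} {wab : a ≫ b = 0} {wcd : c ≫ d = 0}
    (hS : (ShortComplex.mk a b wab).ShortExact) (hT : (ShortComplex.mk c d wcd).ShortExact)
    (φ : B ⟶ H) (ψ : M ⟶ Q) (hφ : a ≫ φ = c) (hψ : b ≫ ψ = φ ≫ d)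
    (hQ : ∀ n : ℕ, n ≠ 0 → IsIso (n • 𝟙 Q)) :
    hS.extClass ∈ maximalDivisibleSubgroup (Abelian.Ext M A 1) := by
  have hnat := ShortComplex.ShortExact.extClass_naturality hS hT
    { τ₁ := 𝟙 A, τ₂ := φ, τ₃ := ψ, comm₁₂ := by simp [hφ], comm₂₃ := by simp [hψ] }
  have he : hS.extClass = (Abelian.Ext.mk₀ ψ).comp hT.extClass (zero_add 1) := by
    rw [← hnat]
    exact (Abelian.Ext.comp_mk₀_id _).symm
  let r : Abelian.Ext Q A 1 →+ Abelian.Ext M A 1 :=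
    AddMonoidHom.mk' (fun x => (Abelian.Ext.mk₀ ψ).comp x (zero_add 1))
      fun x y => Abelian.Ext.comp_add _ _ _ _
  have hr : r.range ≤ maximalDivisibleSubgroup (Abelian.Ext M A 1) := by
    refine le_sSup ?_
    rintro n hn _ ⟨x, rfl⟩
    have := hQ n hn
    refine ⟨_, ⟨(Abelian.Ext.mk₀ (inv (n • 𝟙 Q))).comp x (zero_add 1), rfl⟩, ?_⟩
    have hx : n • (Abelian.Ext.mk₀ (inv (n • 𝟙 Q))).comp x (zero_add 1) = x := by
      rw [← extPullback_apply, ← map_nsmul, extPullback_apply]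
      have : n • inv (n • 𝟙 Q) = 𝟙 Q := by
        rw [← Category.comp_id (inv _), ← Preadditive.comp_nsmul, IsIso.inv_hom_id]
      rw [this, Abelian.Ext.mk₀_id_comp]
    rw [← map_nsmul, hx]
  exact he ▸ hr ⟨_, rfl⟩

/-- Dividing a class repeatedly inside the maximal divisible subgroup is lifted to dividing the
morphism `M ⟶ Q` that induces it. The recursion keeps the class of each `ψ n` in that subgroup; the
outcome satisfies `n! • ψ n = ψ₀`. -/
theorem exists_compatible_sequence {A B M I Q : C} {a : A ⟶ B} {b : B ⟶ M}
    {c : A ⟶ I} {d : I ⟶ Q} {wab : a ≫ b = 0} {wcd : c ≫ d = 0}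
    (hS : (ShortComplex.mk a b wab).ShortExact) (hT : (ShortComplex.mk c d wcd).ShortExact)
    [Injective I] (hM : ∀ n : ℕ, n ≠ 0 → Mono (n • 𝟙 M))
    (hdiv : hS.extClass ∈ maximalDivisibleSubgroup (Abelian.Ext M A 1))
    (φ : B ⟶ I) (ψ₀ : M ⟶ Q) (hφ : a ≫ φ = c) (hψ : b ≫ ψ₀ = φ ≫ d) :
    ∃ ψ : ℕ → (M ⟶ Q), ψ 0 = ψ₀ ∧ ∀ n, (n + 1) • ψ (n + 1) = ψ n := by
  have hnat := ShortComplex.ShortExact.extClass_naturality hS hT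
    { τ₁ := 𝟙 A, τ₂ := φ, τ₃ := ψ₀, comm₁₂ := by simp [hφ], comm₂₃ := by simp [hψ] }
  have he : extPullback hT.extClass M ψ₀ = hS.extClass := by
    rw [extPullback_apply, ← hnat]
    exact Abelian.Ext.comp_mk₀_id _
  have hstep (n : ℕ) (ψ : {ψ : M ⟶ Q // extPullback hT.extClass M ψ ∈
      maximalDivisibleSubgroup (Abelian.Ext M A 1)}) :
      ∃ ψ' : {ψ : M ⟶ Q // extPullback hT.extClass M ψ ∈
        maximalDivisibleSubgroup (Abelian.Ext M A 1)}, (n + 1) • ψ'.1 = ψ.1 := by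
    obtain ⟨ψ, hψ⟩ := ψ
    obtain ⟨y, hy, hyψ⟩ := exists_nsmul_eq_of_mem_maximalDivisibleSubgroup hψ n.succ_ne_zero
    -- As `Ext¹(M, I) = 0`, the divided class comes from some `χ : M ⟶ Q`. The morphism `(n + 1) • χ
    -- - ψ` has zero class, so it lifts to `η : M ⟶ I`.
    obtain ⟨y', rfl⟩ := Abelian.Ext.covariant_sequence_exact₁ _ hT y
      (Abelian.Ext.eq_zero_of_injective _) (zero_add 1)
    obtain ⟨χ, rfl⟩ := (Abelian.Ext.mk₀_bijective M Q).2 y'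
    obtain ⟨z, hz⟩ := Abelian.Ext.covariant_sequence_exact₃ _ hT
      (Abelian.Ext.mk₀ ((n + 1) • χ - ψ)) (zero_add 1) (by
        rw [← extPullback_apply, map_sub, map_nsmul, sub_eq_zero]
        exact hyψ)
    obtain ⟨η, rfl⟩ := (Abelian.Ext.mk₀_bijective M I).2 z
    have hη : η ≫ d = (n + 1) • χ - ψ :=
      (Abelian.Ext.mk₀_bijective M Q).1 (by rw [← hz, Abelian.Ext.mk₀_comp_mk₀])
    have := hM (n + 1) n.succ_ne_zero
    -- `η` is divisible by `n + 1` because `I` is injective and multiplication on `M` is mono.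
    -- Subtracting `η' ≫ d` from `χ` keeps its class and makes the division exact.
    let η' := Injective.factorThru η ((n + 1) • 𝟙 M)
    have hη' : (n + 1) • η' = η := by
      rw [← Injective.comp_factorThru η ((n + 1) • 𝟙 M), Preadditive.nsmul_comp, Category.id_comp]
    refine ⟨⟨χ - η' ≫ d, ?_⟩, ?_⟩
    · rw [map_sub, extPullback_apply _ (η' ≫ d), ← Abelian.Ext.mk₀_comp_mk₀_assoc,
        hT.comp_extClass, Abelian.Ext.comp_zero, sub_zero]
      exact hy
    · change (n + 1) • (χ - η' ≫ d) = ψ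
      rw [smul_sub, ← Preadditive.nsmul_comp, hη', hη, sub_sub_cancel]
  choose next hnext using hstep
  let s : ℕ → {ψ : M ⟶ Q // extPullback hT.extClass M ψ ∈
      maximalDivisibleSubgroup (Abelian.Ext M A 1)} :=
    fun n => Nat.rec ⟨ψ₀, (he.symm ▸ hdiv :)⟩ next n
  exact ⟨fun n => (s n).1, rfl, fun n => hnext n (s n)⟩

end Divisible

/-! ### Extending a group action to a divisible hull -/

section ActionExtension

theorem exists_extension_of_divisible {A B H : Type*} [AddCommGroup A] [AddCommGroup B]
    [AddCommGroup H] (hA : ∀ n : ℕ, n ≠ 0 → ∀ c : A, ∃ c', n • c' = c) (j : B →+ H)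
    (hj : Function.Injective j) (δ : B →+ A) : ∃ ε : H →+ A, ∀ b, ε (j b) = δ b := by
  have hdiv (n : ℤ) (hn : n ≠ 0) (c : A) : ∃ c', n • c' = c := by
    obtain ⟨c', hc'⟩ := hA n.natAbs (by simpa using hn) c
    rcases n.natAbs_eq with h | h
    · exact ⟨c', by rw [h, natCast_zsmul, hc']⟩
    · exact ⟨-c', by rw [h, neg_smul, smul_neg, neg_neg, natCast_zsmul, hc']⟩
  choose div hdiv using hdiv
  let _ : DivisibleBy A ℤ :=
    { div := fun c n => if hn : n = 0 then 0 else div n hn c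
      div_zero := fun c => by simp
      div_cancel := fun {n} c hn => by simp [hn, hdiv] }
  obtain ⟨ε, hε⟩ := (Module.Baer.of_divisible A).extension_property_addMonoidHom _ hj δ
  exact ⟨ε, fun b => DFunLike.congr_fun hε b⟩

variable {B H Q : Type*} [AddCommGroup B] [AddCommGroup H] [AddCommGroup Q]

/-- A sequence of homomorphisms `ψ n` with `(n + 1) • ψ (n + 1) = ψ n` defines a homomorphism on
every group `H ⊇ B` with `H / B` torsion, which restricts to `ψ 0`. -/
theorem exists_hom_of_compatible_sequence (j : B →+ H) (hj : Function.Injective j)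
    (htors : ∀ h : H, ∃ n : ℕ, n ≠ 0 ∧ ∃ b, n • h = j b) (ψ : ℕ → B →+ Q)
    (hψ : ∀ n, (n + 1) • ψ (n + 1) = ψ n) :
    ∃ θ : H →+ Q, ∀ (n : ℕ) (h : H) (b : B), n.factorial • h = j b → θ h = ψ n b := by
  -- The value at `h` is read off from any factorial multiple of `h` in `B`; two choices `M`, `N`
  -- are compared at level `M + N`.
  have hup (M : ℕ) (h : H) (b : B) (hb : M.factorial • h = j b) (t : ℕ) :
      ∃ b', (M + t).factorial • h = j b' ∧ ψ (M + t) b' = ψ M b := by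
    induction t with
    | zero => exact ⟨b, hb, rfl⟩
    | succ t ih =>
      obtain ⟨b', hb', hψb'⟩ := ih
      refine ⟨(M + t + 1) • b', ?_, ?_⟩
      · rw [← add_assoc, Nat.factorial_succ, mul_smul, hb', map_nsmul]
      · rw [← hψb', ← hψ (M + t), map_nsmul]
        rfl
  have hcompat (M N : ℕ) (h : H) (b b' : B) (hb : M.factorial • h = j b)
      (hb' : N.factorial • h = j b') : ψ M b = ψ N b' := by
    obtain ⟨c, hc, hcb⟩ := hup M h b hb N
    obtain ⟨c', hc', hcb'⟩ := hup N h b' hb' M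
    rw [add_comm] at hc' hcb'
    rw [← hcb, ← hcb', hj (hc.symm.trans hc')]
  have hfac (h : H) : ∃ (n : ℕ) (b : B), n.factorial • h = j b := by
    obtain ⟨n, hn, b, hb⟩ := htors h
    refine ⟨n, (n - 1).factorial • b, ?_⟩
    rw [map_nsmul, ← hb, ← mul_smul, mul_comm, Nat.mul_factorial_pred hn]
  choose N b hb using hfac
  refine ⟨AddMonoidHom.mk' (fun h => ψ (N h) (b h)) fun h h' => ?_, fun n h c hc =>
    hcompat _ _ h _ _ (hb h) hc⟩
  obtain ⟨c, hc, hψc⟩ := hup _ h _ (hb h) (N h')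
  obtain ⟨c', hc', hψc'⟩ := hup _ h' _ (hb h') (N h)
  rw [add_comm] at hc' hψc'
  rw [← hψc, ← hψc', ← map_add]
  refine hcompat _ _ (h + h') _ _ (hb _) ?_
  rw [smul_add, hc, hc', map_add]

variable {A I : Type*} [AddCommGroup A] [AddCommGroup I]

/-- Divisible groups are injective, so `I → Q` has an additive section `s`. On `B`, the lift `s ∘ θ`
differs from `φ` by a map into `A`, which extends to `H` and corrects the lift. No equivariance is
available here. -/
theorem exists_lift_of_divisible (hA : ∀ n : ℕ, n ≠ 0 → ∀ c : A, ∃ c', n • c' = c)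
    (a : A →+ B) (j : B →+ H) (hj : Function.Injective j) (φ : B →+ I)
    (hφ : Function.Injective fun c => φ (a c)) (d : I →+ Q) (hd : Function.Surjective d)
    (hexact : ∀ i, d i = 0 ↔ ∃ c, φ (a c) = i) (θ : H →+ Q) (hθ : ∀ b, θ (j b) = d (φ b)) :
    ∃ Θ : H →+ I, (∀ h, d (Θ h) = θ h) ∧ ∀ b, Θ (j b) = φ b := by
  obtain ⟨r, hr⟩ := exists_extension_of_divisible hA (φ.comp a) hφ (.id A)
  have hr' (c : A) : r (φ (a c)) = c := hr c
  have hker (i : I) (hi : d i = 0) : φ (a (r i)) = i := by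
    obtain ⟨c, rfl⟩ := (hexact i).mp hi
    rw [hr']
  let s : Q →+ I := d.liftOfSurjective hd ⟨.id I - (φ.comp a).comp r, fun i hi => by
    change i - φ (a (r i)) = 0
    rw [hker i hi, sub_self]⟩
  have hs (i : I) : s (d i) = i - φ (a (r i)) := d.liftOfRightInverse_comp_apply _ _ _ i
  have hds (q : Q) : d (s q) = q := by
    obtain ⟨i, rfl⟩ := hd q
    rw [hs, map_sub, (hexact _).mpr ⟨_, rfl⟩, sub_zero]
  obtain ⟨ε, hε⟩ := exists_extension_of_divisible hA j hj (r.comp (φ - (s.comp θ).comp j))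
  refine ⟨s.comp θ + (φ.comp a).comp ε, fun h => ?_, fun b => ?_⟩
  · change d (s (θ h) + φ (a (ε h))) = θ h
    rw [map_add, hds, (hexact _).mpr ⟨_, rfl⟩, add_zero]
  · change s (θ (j b)) + φ (a (ε (j b))) = φ b
    rw [hε]
    change s (θ (j b)) + φ (a (r (φ b - s (θ (j b))))) = φ b
    rw [hker _ (by rw [map_sub, hds, hθ, sub_self]), add_sub_cancel]

variable {G : Type*} [Group G]

/-- Extension of a group action on `B` to the divisible hull `H` of `B` relative to `A`. -/
theorem exists_action_of_compatible_sequence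
    (ρB : G →* AddMonoid.End B) (ρI : G →* AddMonoid.End I) (ρQ : G →* AddMonoid.End Q)
    (hA : ∀ n : ℕ, n ≠ 0 → ∀ c : A, ∃ c', n • c' = c)
    (hH : ∀ n : ℕ, n ≠ 0 → ∀ h : H, ∃ h', n • h' = h)
    (a : A →+ B) (j : B →+ H) (hj : Function.Injective j)
    (htors : ∀ h : H, ∃ n : ℕ, n ≠ 0 ∧ ∃ b, n • h = j b)
    (hroots : ∀ n : ℕ, n ≠ 0 → ∀ h : H, n • h = 0 → ∃ c, h = j (a c))
    (φ : B →+ I) (hφG : ∀ g b, φ (ρB g b) = ρI g (φ b))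
    (hφ : Function.Injective fun c => φ (a c)) (d : I →+ Q) (hdG : ∀ g i, d (ρI g i) = ρQ g (d i))
    (hd : Function.Surjective d) (hexact : ∀ i, d i = 0 ↔ ∃ c, φ (a c) = i) (ψ : ℕ → B →+ Q)
    (hψG : ∀ n g b, ψ n (ρB g b) = ρQ g (ψ n b))
    (hψ0 : ∀ b, ψ 0 b = d (φ b)) (hψ : ∀ n, (n + 1) • ψ (n + 1) = ψ n) :
    ∃ τ : G →* AddMonoid.End H, (∀ g b, τ g (j b) = j (ρB g b)) ∧
      ∀ h, ∃ (b : B) (i : I), ∀ g, ρB g b = b → ρI g i = i → τ g h = h := by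
  obtain ⟨θ, hθ⟩ := exists_hom_of_compatible_sequence j hj htors ψ hψ
  obtain ⟨Θ, hdΘ, hΘ⟩ := exists_lift_of_divisible hA a j hj φ hφ d hd hexact θ
    (fun b => (hθ 0 (j b) b (by simp)).trans (hψ0 b))
  -- The graph of `g`. A multiple of `h'` determines it up to torsion, which lies in `A` by
  -- `hroots`; there `Θ` is injective, so the image in `I` settles the rest.
  let P (g : G) (h h' : H) : Prop :=
    Θ h' = ρI g (Θ h) ∧ ∃ n : ℕ, n ≠ 0 ∧ ∃ b, n • h = j b ∧ n • h' = j (ρB g b)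
  have huniq (g : G) (h x y : H) (hx : P g h x) (hy : P g h y) : x = y := by
    obtain ⟨hx, n, hn, b, hb, hb'⟩ := hx
    obtain ⟨hy, m, hm, c, hc, hc'⟩ := hy
    have hbc : m • b = n • c := hj (by
      rw [map_nsmul, map_nsmul, ← hb, ← hc, smul_comm])
    have h0 : (m * n) • (x - y) = 0 := by
      rw [smul_sub, mul_smul, hb', mul_comm, mul_smul, hc', ← map_nsmul, ← map_nsmul,
        ← map_nsmul, ← map_nsmul, hbc, sub_self]
    obtain ⟨z, hz⟩ := hroots _ (mul_ne_zero hm hn) _ h0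
    have hz0 : φ (a z) = φ (a 0) := by
      rw [← hΘ, ← hz, map_sub, hx, hy, sub_self, map_zero, map_zero]
    rw [← sub_eq_zero, hz, hφ hz0, map_zero, map_zero]
  have hex (g : G) (h : H) : ∃ h', P g h h' := by
    obtain ⟨n, hn, b, hb⟩ := htors h
    have hb' : n.factorial • h = j ((n - 1).factorial • b) := by
      rw [map_nsmul, ← hb, ← mul_smul, mul_comm, Nat.mul_factorial_pred hn]
    set b' := (n - 1).factorial • b
    -- Any `h₀` with the right multiple is a candidate. Equivariance of `ψ n` gives `Θ h₀` and `ρI g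
    -- (Θ h)` the same image in `Q`, so they differ by a torsion element `c` of `A`, which is added
    -- to `h₀`.
    obtain ⟨h₀, hh₀⟩ := hH _ n.factorial_ne_zero (j (ρB g b'))
    obtain ⟨c, hc⟩ := (hexact (ρI g (Θ h) - Θ h₀)).mp (by
      rw [map_sub, hdG, hdΘ, hdΘ, hθ n h b' hb', hθ n h₀ _ hh₀, hψG, sub_self])
    have hc0 : n.factorial • c = 0 := hφ (by
      change φ (a (n.factorial • c)) = φ (a 0)
      rw [map_nsmul, map_nsmul, hc, smul_sub, ← map_nsmul, ← map_nsmul, ← map_nsmul, hh₀, hb',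
        hΘ, hΘ, hφG, sub_self, map_zero, map_zero])
    refine ⟨h₀ + j (a c), ?_, n.factorial, n.factorial_ne_zero, b', hb', ?_⟩
    · rw [map_add, hΘ, hc, add_sub_cancel]
    · rw [smul_add, hh₀, ← map_nsmul, ← map_nsmul, hc0, map_zero, map_zero, add_zero]
  choose τ hτ using hex
  have hP_add (g : G) (h₁ h₂ x₁ x₂ : H) (h₁x : P g h₁ x₁) (h₂x : P g h₂ x₂) :
      P g (h₁ + h₂) (x₁ + x₂) := by
    obtain ⟨hx, n, hn, b, hb, hb'⟩ := h₁x
    obtain ⟨hy, m, hm, c, hc, hc'⟩ := h₂x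
    refine ⟨by rw [map_add, map_add, map_add, hx, hy], n * m, mul_ne_zero hn hm,
      m • b + n • c, ?_, ?_⟩
    · rw [smul_add, mul_smul n m h₂, hc, mul_comm, mul_smul, hb, map_add, map_nsmul, map_nsmul]
    · rw [smul_add, mul_smul n m x₂, hc', mul_comm, mul_smul, hb', map_add, map_add, map_nsmul,
        map_nsmul, map_nsmul, map_nsmul]
  have hP_mul (g g' : G) (h x y : H) (hx : P g' h x) (hy : P g x y) : P (g * g') h y := by
    obtain ⟨hx, n, hn, b, hb, hb'⟩ := hx
    obtain ⟨hy, m, hm, c, hc, hc'⟩ := hy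
    have hbc : m • ρB g' b = n • c := hj (by
      rw [map_nsmul, map_nsmul, ← hb', ← hc, smul_comm])
    refine ⟨by rw [hy, hx, map_mul]; rfl, m * n, mul_ne_zero hm hn, m • b, ?_, ?_⟩
    · rw [mul_smul, hb, map_nsmul]
    · rw [mul_comm, mul_smul, hc', map_mul]
      change n • j (ρB g c) = j (ρB g (ρB g' (m • b)))
      rw [map_nsmul (ρB g'), hbc, map_nsmul, map_nsmul]
  refine ⟨
    { toFun := fun g => AddMonoidHom.mk' (τ g) fun h h' =>
        huniq g (h + h') _ _ (hτ g _) (hP_add _ _ _ _ _ (hτ g h) (hτ g h'))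
      map_one' := ?_
      map_mul' := fun g g' => ?_ }, fun g b => ?_, fun h => ?_⟩
  · ext h
    refine huniq 1 h _ _ (hτ 1 h) ⟨by rw [map_one]; rfl, ?_⟩
    obtain ⟨n, hn, b, hb⟩ := htors h
    exact ⟨n, hn, b, hb, by rw [map_one]; exact hb⟩
  · ext h
    exact huniq _ h _ _ (hτ _ h) (hP_mul g g' h _ _ (hτ g' h) (hτ g _))
  · refine huniq g _ _ _ (hτ g _) ⟨by rw [hΘ, hΘ, hφG], 1, one_ne_zero, b, one_smul _ _, one_smul _ _⟩
  · obtain ⟨n, hn, b, hb⟩ := htors h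
    -- Fixing both `b` and `Θ h` forces fixing `h`: this is the source of discreteness of the new
    -- action.
    refine ⟨b, Θ h, fun g hgb hgi => huniq g h _ _ (hτ g h) ⟨hgi.symm, n, hn, b, hb, ?_⟩⟩
    rw [hgb, hb]

end ActionExtension

/-! ### Roots of constants are constants -/

section Constants

theorem hasEnoughRootsOfUnity_of_algebra (κ : Type*) {E : Type*} [Field κ] [CharZero κ]
    [IsSepClosed κ] [Field E] [Algebra κ E] (n : ℕ) (hn : n ≠ 0) : HasEnoughRootsOfUnity E n := by
  have : NeZero n := ⟨hn⟩
  have : NeZero (n : κ) := ⟨Nat.cast_ne_zero.mpr hn⟩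
  obtain ⟨ζ, hζ⟩ := HasEnoughRootsOfUnity.exists_primitiveRoot κ n
  exact { prim := ⟨_, hζ.map_of_injective (algebraMap κ E).injective⟩, cyc := inferInstance }

theorem exists_pow_eq_units {κ : Type*} [Field κ] [CharZero κ] [IsSepClosed κ] {n : ℕ}
    (hn : n ≠ 0) (c : κˣ) : ∃ d : κˣ, d ^ n = c := by
  have : NeZero (n : κ) := ⟨Nat.cast_ne_zero.mpr hn⟩
  obtain ⟨z, hz⟩ := IsSepClosed.exists_pow_nat_eq (c : κ) n
  have hz0 : z ≠ 0 := by
    rintro rfl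
    exact c.ne_zero (hz.symm.trans (zero_pow hn))
  exact ⟨Units.mk0 z hz0, Units.ext hz⟩

/-- Torsion-freeness of `Eˣ/κˣ`: dividing `u` by a root of `c` taken in `κ` leaves a root of unity,
and `κ` already contains those. -/
theorem exists_eq_map_of_pow_eq_map {κ E : Type*} [Field κ] [CharZero κ] [IsSepClosed κ] [Field E]
    [Algebra κ E] {n : ℕ} (hn : n ≠ 0) {u : Eˣ} {c : κˣ}
    (h : u ^ n = Units.map (algebraMap κ E).toMonoidHom c) :
    ∃ d : κˣ, Units.map (algebraMap κ E).toMonoidHom d = u := by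
  have : NeZero n := ⟨hn⟩
  have : NeZero (n : κ) := ⟨Nat.cast_ne_zero.mpr hn⟩
  obtain ⟨d, rfl⟩ := exists_pow_eq_units hn c
  obtain ⟨ζ, hζ⟩ := HasEnoughRootsOfUnity.exists_primitiveRoot κ n
  have h1 : ((u : E) / algebraMap κ E d) ^ n = 1 := by
    have := congrArg Units.val h
    rw [map_pow] at this
    rw [div_pow, div_eq_one_iff_eq (by simp)]
    exact this
  obtain ⟨i, -, hi⟩ := (hζ.map_of_injective (algebraMap κ E).injective).eq_pow_of_pow_eq_one h1
  refine ⟨(hζ.isUnit hn).unit ^ i * d, Units.ext ?_⟩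
  change algebraMap κ E (ζ ^ i * d) = u
  rw [map_mul, map_pow, hi, div_mul_cancel₀]
  simp

end Constants

/-! ### Continuity for the Krull topology -/

section Continuity

variable {F L G : Type*} [Field F] [Field L] [Algebra F L] [Group G] [TopologicalSpace G]

open scoped Topology

/-- A basic neighbourhood of `1` fixes a finite extension, and fixing it only requires fixing
finitely many generators. -/
theorem continuous_of_forall_mem_nhds_one [IsTopologicalGroup G] (s : G →* Gal(L/F))
    (h : ∀ x : L, {g : G | s g x = x} ∈ 𝓝 (1 : G)) : Continuous s := by
  refine continuous_of_continuousAt_one s ?_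
  rw [ContinuousAt, map_one, Filter.tendsto_def]
  intro U hU
  obtain ⟨E, hE, hEU⟩ := (krullTopology_mem_nhds_one_iff F L U).mp hU
  obtain ⟨S, hS⟩ := IntermediateField.essFiniteType_iff.mp
    (inferInstance : Algebra.EssFiniteType F E)
  refine Filter.mem_of_superset ((Filter.biInter_finset_mem S).mpr fun x _ => h x) fun g hg => ?_
  refine hEU ?_
  rw [← hS, SetLike.mem_coe, IntermediateField.mem_fixingSubgroup_iff]
  exact (IntermediateField.forall_mem_adjoin_smul_eq_self_iff F (s g)).mpr
    fun x hx => Set.mem_iInter₂.mp hg x hx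

theorem isOpen_setOf_apply_eq [Algebra.IsIntegral F L] {s : G →* Gal(L/F)} (hs : Continuous s)
    (x : L) : IsOpen {g : G | s g x = x} :=
  (stabilizer_isOpen_of_isIntegral x).preimage hs

end Continuity

/-! ### Galois action and Kummer theory for `k̄(X)` -/

section FunctionFields

variable {k : Type u} [Field k] {X : Scheme.{u}} (f : X ⟶ Spec (.of k))
variable [Smooth f] [GeometricallyIrreducible f]
variable (kbar : Type u) [Field kbar] [Algebra k kbar] [IsSepClosure k kbar]

theorem smul_algebraMap_functionField (σ : Gal(kbar/k)) (x : FunctionField f) :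
    σ • algebraMap (FunctionField f) (GeomFunctionField f kbar) x =
      algebraMap (FunctionField f) (GeomFunctionField f kbar) x :=
  (Algebra.TensorProduct.map_tmul (AlgHom.id k (FunctionField f)) (σ : kbar →ₐ[k] kbar) x 1).trans
    (by rw [map_one]; rfl)

theorem geomFunctionField_induction {motive : GeomFunctionField f kbar → Prop}
    (x : GeomFunctionField f kbar) (zero : motive 0)
    (mul : ∀ (a : FunctionField f) (c : kbar), motive
      (algebraMap (FunctionField f) (GeomFunctionField f kbar) a *
        algebraMap kbar (GeomFunctionField f kbar) c))
    (add : ∀ x y, motive x → motive y → motive (x + y)) : motive x := by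
  refine TensorProduct.induction_on (motive := fun x : FunctionField f ⊗[k] kbar =>
    motive (show GeomFunctionField f kbar from x)) x zero (fun a c => ?_) add
  convert! mul a c using 1
  refine Eq.trans ?_ (Algebra.TensorProduct.tmul_mul_tmul (R := k) a 1 (1 : kbar) c).symm
  rw [mul_one, one_mul]

instance : Algebra.IsIntegral (FunctionField f) (GeomFunctionField f kbar) :=
  inferInstanceAs (Algebra.IsIntegral (FunctionField f) (FunctionField f ⊗[k] kbar))

variable (Ω : Type v) [Field Ω] [Algebra (GeomFunctionField f kbar) Ω]

theorem algebraMap_geomFunctionFieldAb_functionField (x : FunctionField f) :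
    algebraMap (FunctionField f) (GeomFunctionFieldAb f kbar Ω) x =
      algebraMap (GeomFunctionField f kbar) (GeomFunctionFieldAb f kbar Ω)
        (algebraMap (FunctionField f) (GeomFunctionField f kbar) x) := rfl

theorem algebraMap_geomFunctionFieldAb_kbar (x : kbar) :
    algebraMap kbar (GeomFunctionFieldAb f kbar Ω) x =
      algebraMap (GeomFunctionField f kbar) (GeomFunctionFieldAb f kbar Ω)
        (algebraMap kbar (GeomFunctionField f kbar) x) := rfl

instance : IsScalarTower (FunctionField f) (GeomFunctionField f kbar)
    (GeomFunctionFieldAb f kbar Ω) := .of_algebraMap_eq fun _ => rfl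

instance : IsScalarTower kbar (GeomFunctionField f kbar)
    (GeomFunctionFieldAb f kbar Ω) := .of_algebraMap_eq fun _ => rfl

theorem algebraMap_abProjection_apply
    (g : Gal(GeomFunctionFieldAb f kbar Ω/FunctionField f)) (x : kbar) :
    algebraMap kbar (GeomFunctionFieldAb f kbar Ω) (abProjection f kbar Ω g x) =
      g (algebraMap kbar (GeomFunctionFieldAb f kbar Ω) x) :=
  AlgEquiv.restrictNormal_commutes (AlgEquiv.restrictScalars k g) kbar x

/-- An automorphism of `k̄(X)^ab` over `k(X)` acts on `k̄(X)` through its restriction to `k̄`. -/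
theorem apply_algebraMap_geomFunctionField
    (g : Gal(GeomFunctionFieldAb f kbar Ω/FunctionField f)) (x : GeomFunctionField f kbar) :
    g (algebraMap (GeomFunctionField f kbar) (GeomFunctionFieldAb f kbar Ω) x) =
      algebraMap (GeomFunctionField f kbar) (GeomFunctionFieldAb f kbar Ω)
        (abProjection f kbar Ω g • x) := by
  induction x using geomFunctionField_induction with
  | zero => simp
  | mul a c =>
    rw [smul_mul', smul_algebraMap_functionField, smul_algebraMap_geomFunctionField,
      map_mul, map_mul, map_mul, ← algebraMap_geomFunctionFieldAb_functionField, AlgEquiv.commutes,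
      ← algebraMap_geomFunctionFieldAb_kbar, ← algebraMap_geomFunctionFieldAb_kbar,
      algebraMap_abProjection_apply]
  | add x y hx hy => rw [smul_add, map_add, map_add, map_add, hx, hy]

variable [CharZero k]

theorem charZero_kbar (k kbar : Type*) [Field k] [CharZero k] [Field kbar] [Algebra k kbar] :
    CharZero kbar := charZero_of_injective_algebraMap (algebraMap k kbar).injective

theorem charZero_geomFunctionField : CharZero (GeomFunctionField f kbar) :=
  charZero_of_injective_algebraMap (algebraMap k _).injective

theorem hasEnoughRootsOfUnity_geomFunctionField (n : ℕ) (hn : n ≠ 0) :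
    HasEnoughRootsOfUnity (GeomFunctionField f kbar) n :=
  have := charZero_kbar k kbar
  have : IsSepClosed kbar := IsSepClosure.sep_closed k
  hasEnoughRootsOfUnity_of_algebra kbar n hn

theorem isGalois_geomFunctionFieldAb :
    IsGalois (GeomFunctionField f kbar) (GeomFunctionFieldAb f kbar Ω) :=
  have := charZero_geomFunctionField f kbar
  isGalois_maximalAbelianExtension

theorem isIntegral_geomFunctionFieldAb :
    Algebra.IsIntegral (FunctionField f) (GeomFunctionFieldAb f kbar Ω) :=
  have := isGalois_geomFunctionFieldAb f kbar Ω
  Algebra.IsIntegral.trans (GeomFunctionField f kbar)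

theorem span_radicalUnits_geomFunctionFieldAb :
    Submodule.span (GeomFunctionField f kbar) (Set.range
      fun u : radicalUnits (GeomFunctionField f kbar) (GeomFunctionFieldAb f kbar Ω) =>
        ((u : (GeomFunctionFieldAb f kbar Ω)ˣ) : GeomFunctionFieldAb f kbar Ω)) = ⊤ :=
  have := charZero_geomFunctionField f kbar
  span_radicalUnits (hasEnoughRootsOfUnity_geomFunctionField f kbar)

theorem exists_pow_eq_radicalUnits_geomFunctionFieldAb
    [IsSepClosure (GeomFunctionField f kbar) Ω] {n : ℕ} (hn : n ≠ 0)
    (u : radicalUnits (GeomFunctionField f kbar) (GeomFunctionFieldAb f kbar Ω)) :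
    ∃ w, w ^ n = u :=
  have := charZero_geomFunctionField f kbar
  have : IsSepClosed Ω := IsSepClosure.sep_closed (GeomFunctionField f kbar)
  exists_pow_eq_of_radicalUnits (hasEnoughRootsOfUnity_geomFunctionField f kbar) hn u

end FunctionFields

/-! ### Sections of the projection and actions on the radicals -/

section Sections

open scoped Topology

variable {k : Type u} [Field k] {X : Scheme.{u}} (f : X ⟶ Spec (.of k))
variable [Smooth f] [GeometricallyIrreducible f]
variable (kbar : Type u) [Field kbar] [Algebra k kbar] [IsSepClosure k kbar]
variable (Ω : Type v) [Field Ω] [Algebra (GeomFunctionField f kbar) Ω]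

/-- The group of radicals `{x ∈ k̄(X)^ab : xⁿ ∈ k̄(X)ˣ for some n ≥ 1}`. -/
abbrev functionRadicals : Type v :=
  radicalUnits (GeomFunctionField f kbar) (GeomFunctionFieldAb f kbar Ω)

/-- The inclusion of `k̄(X)ˣ` in the group of radicals. -/
noncomputable abbrev functionRadical : (GeomFunctionField f kbar)ˣ →* functionRadicals f kbar Ω :=
  baseRadical (GeomFunctionField f kbar) (GeomFunctionFieldAb f kbar Ω)

/-- `Ω` lives in another universe than the discrete modules; uniqueness of separable closures
bridges the gap. -/
theorem small_functionRadicals [IsSepClosure (GeomFunctionField f kbar) Ω] :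
    Small.{u} (functionRadicals f kbar Ω) := by
  let e := IsSepClosure.equiv (GeomFunctionField f kbar) Ω
    (SeparableClosure (GeomFunctionField f kbar))
  have : Small.{u} Ω := small_of_injective e.injective
  have : Small.{u} (GeomFunctionFieldAb f kbar Ω) :=
    small_of_injective (f := fun x : maximalAbelianExtension (GeomFunctionField f kbar) Ω => (x : Ω))
      Subtype.val_injective
  have : Small.{u} (GeomFunctionFieldAb f kbar Ω)ˣ := small_of_injective Units.val_injective
  exact small_of_injective Subtype.val_injective

variable [CharZero k]

/-- Each `τ σ` extends with `σ` to `L`; multiplicativity in `σ` follows because an endomorphism is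
determined on `K` and on the radicals. Continuity follows because each element of `L` is a finite
combination of radicals. -/
theorem exists_section_of_action
    (τ : Gal(kbar/k) →* Monoid.End (functionRadicals f kbar Ω))
    (hτ : ∀ σ x, τ σ (functionRadical f kbar Ω x) = functionRadical f kbar Ω (σ • x))
    (hcont : ∀ u, {σ | τ σ u = u} ∈ 𝓝 (1 : Gal(kbar/k))) :
    ∃ s : Gal(kbar/k) →* Gal(GeomFunctionFieldAb f kbar Ω/FunctionField f),
      Continuous s ∧ ∀ σ : Gal(kbar/k), abProjection f kbar Ω (s σ) = σ := by
  have := isGalois_geomFunctionFieldAb f kbar Ω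
  have hspan := span_radicalUnits_geomFunctionFieldAb f kbar Ω
  have hext (σ : Gal(kbar/k)) := exists_ringHom_of_radicalUnits
    (hasEnoughRootsOfUnity_geomFunctionField f kbar) hspan
    (MulSemiringAction.toRingHom Gal(kbar/k) (GeomFunctionField f kbar) σ) (τ σ) (hτ σ)
  choose φ hφK hφH using hext
  replace hφK (σ : Gal(kbar/k)) (x : GeomFunctionField f kbar) :
    φ σ (algebraMap _ _ x) = algebraMap _ _ (σ • x) := hφK σ x
  have h_one : φ 1 = .id _ := by
    refine ringHom_ext_of_radicalUnits hspan (fun x => ?_) fun u => ?_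
    · rw [hφK, one_smul]; rfl
    · rw [hφH, map_one]; rfl
  have h_mul (σ σ' : Gal(kbar/k)) : φ (σ * σ') = (φ σ).comp (φ σ') := by
    refine ringHom_ext_of_radicalUnits hspan (fun x => ?_) fun u => ?_
    · rw [hφK, RingHom.comp_apply, hφK, hφK, mul_smul]
    · rw [hφH, RingHom.comp_apply, hφH, hφH, map_mul]; rfl
  let s₀ : Gal(kbar/k) →*
      (GeomFunctionFieldAb f kbar Ω →ₐ[FunctionField f] GeomFunctionFieldAb f kbar Ω) :=
    { toFun := fun σ => { φ σ with
        commutes' := fun x => by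
          change φ σ (algebraMap _ _ x) = _
          rw [algebraMap_geomFunctionFieldAb_functionField, hφK, smul_algebraMap_functionField] }
      map_one' := AlgHom.ext fun x => RingHom.congr_fun h_one x
      map_mul' := fun σ σ' => AlgHom.ext fun x => RingHom.congr_fun (h_mul σ σ') x }
  -- A homomorphism from a group to a monoid of endomorphisms takes invertible values.
  let s : Gal(kbar/k) →* Gal(GeomFunctionFieldAb f kbar Ω/FunctionField f) :=
    (AlgEquiv.algHomUnitsEquiv _ _).toMonoidHom.comp s₀.toHomUnits
  have hs (σ : Gal(kbar/k)) (x : GeomFunctionFieldAb f kbar Ω) : s σ x = φ σ x := rfl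
  refine ⟨s, continuous_of_forall_mem_nhds_one s fun x => ?_, fun σ => ?_⟩
  · have hx : x ∈ Submodule.span (GeomFunctionField f kbar) (Set.range
        fun u : functionRadicals f kbar Ω =>
          ((u : (GeomFunctionFieldAb f kbar Ω)ˣ) : GeomFunctionFieldAb f kbar Ω)) :=
      hspan ▸ Submodule.mem_top
    induction hx using Submodule.span_induction with
    | mem y hy =>
      obtain ⟨u, rfl⟩ := hy
      refine Filter.mem_of_superset (hcont u) fun σ hσ => ?_
      exact (hs σ _).trans ((hφH σ u).trans (congrArg
        (fun u : functionRadicals f kbar Ω => ((u : (GeomFunctionFieldAb f kbar Ω)ˣ) : GeomFunctionFieldAb f kbar Ω)) hσ))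
    | zero => simp
    | add x y _ _ hx hy =>
      refine Filter.mem_of_superset (Filter.inter_mem hx hy) fun σ hσ => ?_
      exact (map_add (s σ) x y).trans (congrArg₂ (· + ·) hσ.1 hσ.2)
    | smul c x _ hx =>
      have hc := (isOpen_stabilizer_geomFunctionField f kbar c).mem_nhds
        (one_mem (MulAction.stabilizer Gal(kbar/k) c))
      refine Filter.mem_of_superset (Filter.inter_mem hc hx) fun σ hσ => ?_
      change s σ (c • x) = c • x
      rw [Algebra.smul_def, map_mul, show s σ x = x from hσ.2, hs, hφK, show σ • c = c from hσ.1]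
  · ext x
    apply (algebraMap kbar (GeomFunctionFieldAb f kbar Ω)).injective
    rw [algebraMap_abProjection_apply, hs, algebraMap_geomFunctionFieldAb_kbar, hφK,
      smul_algebraMap_geomFunctionField, ← algebraMap_geomFunctionFieldAb_kbar]

/-- `s σ` acts on `k̄(X)` through `σ`, so it permutes the elements having a power in `k̄(X)ˣ`. -/
theorem exists_action_of_section (s : Gal(kbar/k) →* Gal(GeomFunctionFieldAb f kbar Ω/FunctionField f))
    (hs : Continuous s) (hsσ : ∀ σ : Gal(kbar/k), abProjection f kbar Ω (s σ) = σ) :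
    ∃ τ : Gal(kbar/k) →* Monoid.End (functionRadicals f kbar Ω),
      (∀ σ x, τ σ (functionRadical f kbar Ω x) = functionRadical f kbar Ω (σ • x)) ∧
      ∀ u, IsOpen {σ | τ σ u = u} := by
  have := isIntegral_geomFunctionFieldAb f kbar Ω
  let act (σ : Gal(kbar/k)) : (GeomFunctionFieldAb f kbar Ω)ˣ →* (GeomFunctionFieldAb f kbar Ω)ˣ :=
    Units.map (s σ : GeomFunctionFieldAb f kbar Ω →* GeomFunctionFieldAb f kbar Ω)
  have hact (σ : Gal(kbar/k)) (x : (GeomFunctionField f kbar)ˣ) :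
      act σ (functionRadical f kbar Ω x) = functionRadical f kbar Ω (σ • x) := by
    refine Units.ext ?_
    refine (apply_algebraMap_geomFunctionField f kbar Ω (s σ) x).trans ?_
    rw [hsσ]
    rfl
  have hmem (σ : Gal(kbar/k)) (u : functionRadicals f kbar Ω) : act σ u ∈
      radicalUnits (GeomFunctionField f kbar) (GeomFunctionFieldAb f kbar Ω) := by
    obtain ⟨n, hn, x, hx⟩ := exists_pow_eq_baseRadical u
    refine mem_radicalUnits_of_pow_mem hn ?_
    rw [← map_pow, ← SubmonoidClass.coe_pow, hx, hact]
    exact Subtype.property _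
  refine ⟨{ toFun := fun σ => ((act σ).comp (Subgroup.subtype _)).codRestrict _ (hmem σ)
            map_one' := ?_
            map_mul' := fun σ σ' => ?_ }, fun σ x => Subtype.ext (hact σ x), fun u => ?_⟩
  · refine MonoidHom.ext fun u => Subtype.ext (Units.ext ?_)
    change s 1 _ = _
    rw [map_one]
    rfl
  · refine MonoidHom.ext fun u => Subtype.ext (Units.ext ?_)
    change s (σ * σ') _ = _
    rw [map_mul]
    rfl
  · convert! isOpen_setOf_apply_eq hs ((u : (GeomFunctionFieldAb f kbar Ω)ˣ) :
      GeomFunctionFieldAb f kbar Ω) using 2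
    ext σ
    exact Subtype.ext_iff.trans Units.ext_iff

end Sections

/-! ### Discrete modules in terms of elements -/

section DiscreteModules

variable {G : Type u} [Group G] [TopologicalSpace G]

/-- The discrete module attached to an action of `G` on a commutative group. -/
noncomputable def discreteModuleOfAction {N : Type u} [CommGroup N] (τ : G →* Monoid.End N)
    (hτ : ∀ u, IsOpen {g | τ g u = u}) : DiscreteModuleCat ℤ G where
  obj :=
    letI : MulDistribMulAction G N :=
      { smul := fun g x => τ g x
        one_smul := fun x => DFunLike.congr_fun (map_one τ) x
        mul_smul := fun g h x => DFunLike.congr_fun (map_mul τ g h) x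
        smul_mul := fun g => map_mul (τ g)
        smul_one := fun g => map_one (τ g) }
    Rep.ofMulDistribMulAction G N
  property := fun (a : Additive N) => hτ a.toMul

end DiscreteModules

section DiscreteModulesOverRing

variable {R : Type} [CommRing R] {G : Type u} [Group G] [TopologicalSpace G]

/-- The underlying action of a discrete module by additive endomorphisms. -/
def additiveAction (A : DiscreteModuleCat R G) : G →* AddMonoid.End A.obj where
  toFun g := (A.obj.ρ g).toAddMonoidHom
  map_one' := AddMonoidHom.ext fun x => LinearMap.congr_fun (map_one A.obj.ρ) x
  map_mul' g h := AddMonoidHom.ext fun x => LinearMap.congr_fun (map_mul A.obj.ρ g h) x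

theorem setOf_additiveAction_eq_mem_nhds_one (A : DiscreteModuleCat R G) (x : A.obj) :
    {g | additiveAction A g x = x} ∈ nhds (1 : G) :=
  (A.property x).mem_nhds (LinearMap.congr_fun (map_one A.obj.ρ) x)

/-- The underlying additive homomorphism of a morphism of discrete modules. -/
def underlyingAddHom {A B : DiscreteModuleCat R G} (m : A ⟶ B) : A.obj →+ B.obj :=
  m.hom.hom.toLinearMap.toAddMonoidHom

theorem underlyingAddHom_additiveAction {A B : DiscreteModuleCat R G} (m : A ⟶ B) (g : G)
    (x : A.obj) : underlyingAddHom m (additiveAction A g x) =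
      additiveAction B g (underlyingAddHom m x) := Rep.hom_comm_apply m.hom g x

theorem nsmul_hom_apply {A B : DiscreteModuleCat R G} (m : A ⟶ B) (n : ℕ) (x : A.obj) :
    (n • m).hom.hom x = n • m.hom.hom x := by
  induction n with
  | zero => rw [zero_smul, zero_smul]; rfl
  | succ n ih => rw [add_smul, add_smul, one_smul, one_smul, ← ih]; rfl

theorem nsmul_id_hom_apply (A : DiscreteModuleCat R G) (n : ℕ) (x : A.obj) :
    (n • 𝟙 A : A ⟶ A).hom.hom x = n • x :=
  nsmul_hom_apply _ n x

theorem epi_nsmul_id (A : DiscreteModuleCat R G) (n : ℕ) (h : ∀ x : A.obj, ∃ y, n • y = x) :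
    Epi (n • 𝟙 A) := by
  refine (isDiscreteRep R G).ι.epi_of_epi_map ((Rep.epi_iff_surjective _).mpr fun x => ?_)
  obtain ⟨y, rfl⟩ := h x
  exact ⟨y, nsmul_id_hom_apply A n y⟩

variable [IsTopologicalGroup G]

theorem mono_nsmul_id (A : DiscreteModuleCat R G) (n : ℕ) (h : ∀ x : A.obj, n • x = 0 → x = 0) :
    Mono (n • 𝟙 A) := by
  rw [mono_iff_injective_discrete]
  intro x y hxy
  rw [nsmul_id_hom_apply, nsmul_id_hom_apply] at hxy
  exact sub_eq_zero.mp (h _ (by rw [smul_sub, hxy, sub_self]))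

/-- The map induced on quotients by a commutative square. -/
theorem exists_quotientSequence_map {A B A' B' : DiscreteModuleCat R G} (i : A ⟶ B) (i' : A' ⟶ B')
    (hi : Function.Injective i.hom.hom) (α : A ⟶ A')
    (φ : B ⟶ B') (h : i ≫ φ = α ≫ i') :
    ∃ ψ : (quotientSequence i).X₃ ⟶ (quotientSequence i').X₃,
      (quotientSequence i).g ≫ ψ = φ ≫ (quotientSequence i').g := by
  have hS := quotientSequence_shortExact i hi
  have := hS.epi_g
  refine ⟨hS.exact.desc (φ ≫ (quotientSequence i').g) ?_, hS.exact.g_desc _ _⟩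
  change i ≫ φ ≫ (quotientSequence i').g = 0
  exact (Category.assoc i φ _).symm.trans ((congrArg (· ≫ (quotientSequence i').g) h).trans
    ((Category.assoc α i' _).trans ((congrArg (α ≫ ·) (quotientSequence i').zero).trans
      Limits.comp_zero)))

theorem quotientSequence_g_surjective {A B : DiscreteModuleCat R G} (i : A ⟶ B) :
    Function.Surjective (quotientSequence i).g.hom.hom := Submodule.mkQ_surjective _

theorem quotientSequence_g_eq_zero_iff {A B : DiscreteModuleCat R G} (i : A ⟶ B) (b : B.obj) :
    (quotientSequence i).g.hom.hom b = 0 ↔ ∃ a, i.hom.hom a = b :=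
  Submodule.Quotient.mk_eq_zero _

/-- Hypothesis `h` makes the image of `A` saturated for division by `n`, so the quotient has no
`n`-torsion. -/
theorem mono_nsmul_id_quotientSequence {A B : DiscreteModuleCat R G} (i : A ⟶ B) (n : ℕ)
    (h : ∀ (b : B.obj) (a : A.obj), i.hom.hom a = n • b → ∃ a', i.hom.hom a' = b) :
    Mono (n • 𝟙 (quotientSequence i).X₃) := by
  refine mono_nsmul_id _ n fun x hx => ?_
  obtain ⟨b, rfl⟩ := quotientSequence_g_surjective i x
  have hnb : (quotientSequence i).g.hom.hom (n • b) = 0 :=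
    (map_nsmul (quotientSequence i).g.hom.hom n b).trans hx
  obtain ⟨a, ha⟩ := (quotientSequence_g_eq_zero_iff i _).mp hnb
  exact (quotientSequence_g_eq_zero_iff i _).mpr (h b a ha)

theorem isIso_nsmul_id_quotientSequence {A B : DiscreteModuleCat R G} (i : A ⟶ B) (n : ℕ)
    (h : ∀ (b : B.obj) (a : A.obj), i.hom.hom a = n • b → ∃ a', i.hom.hom a' = b)
    (h' : ∀ b : B.obj, ∃ b', n • b' = b) :
    IsIso (n • 𝟙 (quotientSequence i).X₃) := by
  have := mono_nsmul_id_quotientSequence i n h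
  have := epi_nsmul_id (quotientSequence i).X₃ n fun x => by
    obtain ⟨b, rfl⟩ := quotientSequence_g_surjective i x
    obtain ⟨b', rfl⟩ := h' b
    exact ⟨_, (map_nsmul (quotientSequence i).g.hom.hom n b').symm⟩
  exact isIso_of_mono_of_epi _

end DiscreteModulesOverRing

/-! ### Actions on the radicals and the elementary obstruction -/

section Main

open scoped Topology

variable {k : Type u} [Field k] {X : Scheme.{u}} (f : X ⟶ Spec (.of k))
variable [Smooth f] [GeometricallyIrreducible f]
variable (kbar : Type u) [Field kbar] [Algebra k kbar] [IsSepClosure k kbar]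
variable (Ω : Type v) [Field Ω] [Algebra (GeomFunctionField f kbar) Ω] [CharZero k]

theorem exists_constant_of_pow_eq_constant {u : functionRadicals f kbar Ω} {n : ℕ} (hn : n ≠ 0)
    {c : kbarˣ} (h : u ^ n = functionRadical f kbar Ω
      (Units.map (algebraMap kbar (GeomFunctionField f kbar)).toMonoidHom c)) :
    ∃ d : kbarˣ, functionRadical f kbar Ω
      (Units.map (algebraMap kbar (GeomFunctionField f kbar)).toMonoidHom d) = u := by
  have := charZero_kbar k kbar
  have : IsSepClosed kbar := IsSepClosure.sep_closed k
  obtain ⟨d, hd⟩ := exists_eq_map_of_pow_eq_map (κ := kbar) hn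
    (u := (u : (GeomFunctionFieldAb f kbar Ω)ˣ)) (c := c) (congrArg Subtype.val h)
  exact ⟨d, Subtype.ext hd⟩

/-- The action makes the radicals a discrete module containing `k̄(X)ˣ`, whose quotient by `k̄ˣ` is
uniquely divisible: injectivity of `n` is `exists_constant_of_pow_eq_constant`, surjectivity the
existence of roots. -/
theorem mem_maximalDivisibleSubgroup_of_action [IsSepClosure (GeomFunctionField f kbar) Ω]
    (τ : Gal(kbar/k) →* Monoid.End (functionRadicals f kbar Ω))
    (hτ : ∀ σ x, τ σ (functionRadical f kbar Ω x) = functionRadical f kbar Ω (σ • x))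
    (hopen : ∀ u, IsOpen {σ | τ σ u = u}) :
    elementaryObstruction f kbar ∈ maximalDivisibleSubgroup
      (Abelian.Ext (functionUnitsModConstants f kbar) (constantUnits kbar (k := k)) 1) := by
  have := small_functionRadicals f kbar Ω
  let N : Type u := Shrink.{u} (functionRadicals f kbar Ω)
  let e : N ≃* functionRadicals f kbar Ω := Shrink.mulEquiv
  let τ' : Gal(kbar/k) →* Monoid.End N :=
    { toFun := fun σ => e.symm.toMonoidHom.comp ((τ σ).comp e.toMonoidHom)
      map_one' := MonoidHom.ext fun x => by
        change e.symm (τ 1 (e x)) = x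
        rw [map_one]
        exact e.symm_apply_apply x
      map_mul' := fun σ σ' => MonoidHom.ext fun x => by
        change e.symm (τ (σ * σ') (e x)) = e.symm (τ σ (e (e.symm (τ σ' (e x)))))
        rw [map_mul, e.apply_symm_apply]
        rfl }
  have hτ' (σ : Gal(kbar/k)) (x : N) : τ' σ x = e.symm (τ σ (e x)) := rfl
  let D : DiscreteModuleCat ℤ Gal(kbar/k) := discreteModuleOfAction τ' fun x => by
    convert! hopen (e x) using 2
    ext σ
    exact e.symm_apply_eq
  let φ : functionUnits f kbar ⟶ D := (isDiscreteRep ℤ Gal(kbar/k)).homMk (Rep.ofHom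
    ⟨(e.symm.toMonoidHom.comp (functionRadical f kbar Ω)).toAdditive.toIntLinearMap, fun σ => by
      refine LinearMap.ext fun (a : Additive (GeomFunctionField f kbar)ˣ) => ?_
      refine congrArg Additive.ofMul (?_ : e.symm (functionRadical f kbar Ω (σ • a.toMul)) =
        τ' σ (e.symm (functionRadical f kbar Ω a.toMul)))
      rw [hτ', e.apply_symm_apply, hτ]⟩)
  let c := constantUnitsInclusion f kbar ≫ φ
  have hc : Function.Injective c.hom.hom := by
    intro a b hab
    refine constantUnitsInclusion_injective f kbar ?_
    exact congrArg Additive.ofMul (baseRadical_injective (e.symm.injective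
      (congrArg Additive.toMul hab)))
  obtain ⟨ψ, hψ⟩ := exists_quotientSequence_map (constantUnitsInclusion f kbar) c
    (constantUnitsInclusion_injective f kbar) (𝟙 _) φ (Category.id_comp c).symm
  refine extClass_mem_maximalDivisibleSubgroup (unitsSequence_shortExact f kbar)
    (quotientSequence_shortExact c hc) φ ψ rfl hψ fun n hn =>
      isIso_nsmul_id_quotientSequence c n (fun (y : Additive N) (a : Additive kbarˣ) ha => ?_)
        fun (y : Additive N) => ?_
  · have hy : e y.toMul ^ n = functionRadical f kbar Ω
        (Units.map (algebraMap kbar (GeomFunctionField f kbar)).toMonoidHom a.toMul) := by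
      have h : y.toMul ^ n = e.symm (functionRadical f kbar Ω
          (Units.map (algebraMap kbar (GeomFunctionField f kbar)).toMonoidHom a.toMul)) :=
        congrArg Additive.toMul ha.symm
      rw [← map_pow, h, e.apply_symm_apply]
    obtain ⟨b, hb⟩ := exists_constant_of_pow_eq_constant f kbar Ω hn hy
    exact ⟨Additive.ofMul b, congrArg Additive.ofMul ((e.symm_apply_eq).mpr hb)⟩
  · obtain ⟨z, hz⟩ := exists_pow_eq_radicalUnits_geomFunctionFieldAb f kbar Ω hn (e y.toMul)
    refine ⟨Additive.ofMul (e.symm z), congrArg Additive.ofMul (?_ : e.symm z ^ n = y.toMul)⟩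
    rw [← map_pow, hz]
    exact e.symm_apply_apply _

theorem exists_action_of_mem_maximalDivisibleSubgroup [IsSepClosure (GeomFunctionField f kbar) Ω]
    (h : elementaryObstruction f kbar ∈ maximalDivisibleSubgroup
      (Abelian.Ext (functionUnitsModConstants f kbar) (constantUnits kbar (k := k)) 1)) :
    ∃ τ : Gal(kbar/k) →* Monoid.End (functionRadicals f kbar Ω),
      (∀ σ x, τ σ (functionRadical f kbar Ω x) = functionRadical f kbar Ω (σ • x)) ∧
      ∀ u, {σ | τ σ u = u} ∈ 𝓝 (1 : Gal(kbar/k)) := by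
  have := charZero_kbar k kbar
  have : IsSepClosed kbar := IsSepClosure.sep_closed k
  obtain ⟨I, c, hI, hc⟩ := exists_injective_embedding (constantUnits kbar (k := k))
  have := (mono_iff_injective_discrete _).mpr (constantUnitsInclusion_injective f kbar)
  -- Extending `c` to `k̄(X)ˣ` exhibits the obstruction as the pullback of the class of `I` along
  -- the induced `ψ₀`.
  let φ : functionUnits f kbar ⟶ I := Injective.factorThru c (constantUnitsInclusion f kbar)
  have hφ : constantUnitsInclusion f kbar ≫ φ = c := Injective.comp_factorThru _ _
  obtain ⟨ψ₀, hψ₀⟩ := exists_quotientSequence_map (constantUnitsInclusion f kbar) c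
    (constantUnitsInclusion_injective f kbar) (𝟙 _) φ (hφ.trans (Category.id_comp c).symm)
  have hmono (n : ℕ) (hn : n ≠ 0) : Mono (n • 𝟙 (functionUnitsModConstants f kbar)) := by
    refine mono_nsmul_id_quotientSequence _ n fun (y : Additive (GeomFunctionField f kbar)ˣ)
      (a : Additive kbarˣ) ha => ?_
    have ha' : y.toMul ^ n = Units.map (algebraMap kbar (GeomFunctionField f kbar)).toMonoidHom
      a.toMul := (congrArg Additive.toMul ha).symm
    obtain ⟨d, hd⟩ := exists_eq_map_of_pow_eq_map hn ha'
    exact ⟨Additive.ofMul d, congrArg Additive.ofMul hd⟩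
  obtain ⟨ψ, rfl, hψ⟩ := exists_compatible_sequence (unitsSequence_shortExact f kbar)
    (quotientSequence_shortExact c hc) hmono h φ ψ₀ hφ hψ₀
  let b : Additive kbarˣ →+ Additive (GeomFunctionField f kbar)ˣ :=
    (Units.map (algebraMap kbar (GeomFunctionField f kbar)).toMonoidHom).toAdditive
  let j : Additive (GeomFunctionField f kbar)ˣ →+ Additive (functionRadicals f kbar Ω) :=
    (functionRadical f kbar Ω).toAdditive
  let Q := (quotientSequence c).X₃
  let d : I ⟶ Q := (quotientSequence c).g
  let q : functionUnits f kbar ⟶ functionUnitsModConstants f kbar := (unitsSequence f kbar).g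
  have hcoe (x : Additive kbarˣ) : φ.hom.hom (b x) = c.hom.hom x :=
    congrArg (fun m => m.hom.hom x) hφ
  have hdivA (n : ℕ) (hn : n ≠ 0) (x : Additive kbarˣ) : ∃ y, n • y = x := by
    obtain ⟨y, hy⟩ := exists_pow_eq_units hn x.toMul
    exact ⟨Additive.ofMul y, congrArg Additive.ofMul hy⟩
  have hdivH (n : ℕ) (hn : n ≠ 0) (x : Additive (functionRadicals f kbar Ω)) :
      ∃ y, n • y = x := by
    obtain ⟨y, hy⟩ := exists_pow_eq_radicalUnits_geomFunctionFieldAb f kbar Ω hn x.toMul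
    exact ⟨Additive.ofMul y, congrArg Additive.ofMul hy⟩
  have hj : Function.Injective j := fun x y hxy => congrArg Additive.ofMul
    (baseRadical_injective (congrArg Additive.toMul hxy))
  have htors (x : Additive (functionRadicals f kbar Ω)) :
      ∃ n : ℕ, n ≠ 0 ∧ ∃ y, n • x = j y := by
    obtain ⟨n, hn, y, hy⟩ := exists_pow_eq_baseRadical x.toMul
    exact ⟨n, hn, Additive.ofMul y, congrArg Additive.ofMul hy⟩
  have hroots (n : ℕ) (hn : n ≠ 0) (x : Additive (functionRadicals f kbar Ω)) (hx : n • x = 0) :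
      ∃ y, x = j (b y) := by
    have hx' : x.toMul ^ n = functionRadical f kbar Ω
        (Units.map (algebraMap kbar (GeomFunctionField f kbar)).toMonoidHom 1) := by
      rw [map_one, map_one]
      exact congrArg Additive.toMul hx
    obtain ⟨y, hy⟩ := exists_constant_of_pow_eq_constant f kbar Ω hn hx'
    exact ⟨Additive.ofMul y, congrArg Additive.ofMul hy.symm⟩
  have hexact (i : I.obj) : underlyingAddHom d i = 0 ↔ ∃ x, underlyingAddHom φ (b x) = i := by
    refine (quotientSequence_g_eq_zero_iff c i).trans
      (exists_congr fun (x : Additive kbarˣ) => ?_)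
    rw [← hcoe x]
    rfl
  have hψ' (n : ℕ) : (n + 1) • underlyingAddHom (q ≫ ψ (n + 1)) = underlyingAddHom (q ≫ ψ n) := by
    refine AddMonoidHom.ext fun x => ?_
    exact (nsmul_hom_apply (ψ (n + 1)) (n + 1) (q.hom.hom x)).symm.trans
      (congrArg (fun m => m.hom.hom (q.hom.hom x)) (hψ n))
  -- The maps `ψ n` are used on `k̄(X)ˣ` through its projection `q`.
  obtain ⟨τ, hτj, hτopen⟩ := exists_action_of_compatible_sequence
    (B := Additive (GeomFunctionField f kbar)ˣ)
    (additiveAction (functionUnits f kbar)) (additiveAction I) (additiveAction Q)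
    hdivA hdivH b j hj htors hroots
    (underlyingAddHom φ) (underlyingAddHom_additiveAction φ)
    (fun x y hxy => hc ((hcoe x).symm.trans (hxy.trans (hcoe y))))
    (underlyingAddHom d) (underlyingAddHom_additiveAction d) (quotientSequence_g_surjective c)
    hexact (fun n => underlyingAddHom (q ≫ ψ n))
    (fun n => underlyingAddHom_additiveAction (q ≫ ψ n))
    (fun x => congrArg (fun m => m.hom.hom x) hψ₀) hψ'
  refine ⟨
    { toFun := fun σ => AddMonoidHom.toMultiplicative (τ σ)
      map_one' := by rw [map_one]; rfl
      map_mul' := fun σ σ' => by rw [map_mul]; rfl },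
    fun σ x => congrArg Additive.toMul (hτj σ (Additive.ofMul x)), fun u => ?_⟩
  obtain ⟨y, i, hyi⟩ := hτopen (Additive.ofMul u)
  filter_upwards [setOf_additiveAction_eq_mem_nhds_one (functionUnits f kbar) y,
    setOf_additiveAction_eq_mem_nhds_one I i] with σ hσy hσi
  exact congrArg Additive.toMul (hyi σ hσy hσi)

end Main

end BirationalSections

/-- Let `X` be a smooth and geometrically irreducible variety over a field `k` of characteristic `0`,
`k̄` a separable closure of `k`, and `Ω` a separable closure of `k̄(X) = k(X) ⊗[k] k̄`. The projection
`Gal(k̄(X)^ab/k(X)) → Gal(k̄/k)` admits a section in the category of profinite groups if and only if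
`ob(X)` belongs to the maximal divisible subgroup of `Ext¹(k̄(X)ˣ/k̄ˣ, k̄ˣ)`. -/
theorem theorem3p2 {k : Type u} [Field k] [CharZero k]
    {X : Scheme.{u}} (f : X ⟶ Spec (.of k)) [IsSeparated f] [QuasiCompact f]
    [Smooth f] [GeometricallyIrreducible f]
    (kbar : Type u) [Field kbar] [Algebra k kbar] [IsSepClosure k kbar]
    (Ω : Type v) [Field Ω] [Algebra (GeomFunctionField f kbar) Ω]
    [IsSepClosure (GeomFunctionField f kbar) Ω] :
    (∃ s : Gal(kbar/k) →* Gal(GeomFunctionFieldAb f kbar Ω/FunctionField f),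
      Continuous s ∧ ∀ σ : Gal(kbar/k), abProjection f kbar Ω (s σ) = σ) ↔
    elementaryObstruction f kbar ∈
      maximalDivisibleSubgroup
        (Abelian.Ext (functionUnitsModConstants f kbar) (constantUnits kbar (k := k)) 1) := by
  constructor
  · rintro ⟨s, hs, hsσ⟩
    obtain ⟨τ, hτ, hopen⟩ := exists_action_of_section f kbar Ω s hs hsσ
    exact mem_maximalDivisibleSubgroup_of_action f kbar Ω τ hτ hopen
  · intro h
    obtain ⟨τ, hτ, hcont⟩ := exists_action_of_mem_maximalDivisibleSubgroup f kbar Ω h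
    exact exists_section_of_action f kbar Ω τ hτ hcont
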